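/- Let $k$ be a commutative ring; all algebras are associative unital $k$-algebras (not necessarily commutative) and $\otimes=\otimes_k$. Let $H$ and $K$ be Hopf algebras over $k$. A left $H$-Galois object is a left $H$-comodule algebra $A$, with coaction $\delta\colon A\to H\otimes A$, which is faithfully flat over $k$, whose subalgebra of coinvariants $\{a\in A\mid \delta(a)=1\otimes a\}$ is $k$, and whose canonical map $A\otimes A\to H\otimes A$, $a\otimes a'\mapsto \delta(a)(1\otimes a')$, is bijective. Right Galois objects are defined symmetrically, with canonical map $a\otimes a'\mapsto (a\otimes 1)\delta(a')$. An $H$-$K$-bi-Galois object is an $H$-$K$-bicomodule algebra that is both a left $H$-Galois object and a right $K$-Galois object. Let $\mathrm{Gal}_k(H)$ be the set of isomorphism classes $[A]$ of left $H$-Galois objects, where isomorphisms are isomorphisms of $H$-comodule algebras. Put $H[t]=H\otimes k[t]$, a Hopf algebra over $k[t]$. For $i\in\{0,1\}$, the evaluation $k[t]\to k$, $t\mapsto i$, sends an $H[t]$-Galois object $A$ over $k[t]$ to the $H$-comodule algebra $[i]_*(A)=k\otimes_{k[t]}A$, where $k\otimes_{k[t]}H[t]$ is identified with $H$. For $[A_0],[A_1]\in\mathrm{Gal}_k(H)$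 write $[A_0]\sim[A_1]$ if there is a left $H[t]$-Galois object $A$ over $k[t]$ with $[0]_*(A)\cong A_0$ and $[1]_*(A)\cong A_1$. Let $\mathcal H_k(H)$ be the set of homotopy classes, i.e. the quotient of $\mathrm{Gal}_k(H)$ by the equivalence relation generated by $\sim$. **Proposition 1.** Let $Z$ be an $H$-$K$-bi-Galois object. For every left $K$-Galois object $A$, the cotensor product $Z\,\square_K A\subseteq Z\otimes A$, that is, the equalizer of $\rho_Z\otimes\mathrm{id}_A$ and $\mathrm{id}_Z\otimes\delta_A$ for the right $K$-coaction $\rho_Z$ of $Z$ and the left $K$-coaction $\delta_A$ of $A$, with the left $H$-coaction induced from $Z$, is a left $H$-Galois object, and $\varphi_Z([A])=[Z\,\square_K A]$ defines a bijection $\varphi_Z\colon \mathrm{Gal}_k(K)\to\mathrm{Gal}_k(H)$. For all $x,y\in\mathrm{Gal}_k(K)$ one has $x\sim y$ if and only if $\varphi_Z(x)\sim\varphi_Z(y)$, and $\varphi_Z$ induces a bijection $\overline{\varphi_Z}\colon\mathcal H_k(K)\to\mathcal H_k(H)$ between the homotopy classes of left $K$-Galois objects and those of left $H$-Galois objects.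 -/

import Mathlib

open scoped TensorProduct Polynomial

universe u

noncomputable section

/-- A left `H`-comodule algebra over the commutative ring `k`: a (not necessarily commutative)
`k`-algebra with a coassociative and counital coaction `A → H ⊗ A` which is an algebra map. -/
structure LeftComoduleAlgebra (k H : Type u) [CommRing k] [Ring H] [Bialgebra k H] :
    Type (u + 1) where
  /-- the underlying type -/
  carrier : Type u
  [ring : Ring carrier]
  [algebra : Algebra k carrier]
  /-- the coaction -/
  coact : carrier →ₐ[k] H ⊗[k] carrier
  coassoc : ∀ a, Algebra.TensorProduct.assoc k k k H H carrier
      (Algebra.TensorProduct.map (Bialgebra.comulAlgHom k H) (AlgHom.id k carrier) (coact a)) =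
    Algebra.TensorProduct.map (AlgHom.id k H) coact (coact a)
  counit : ∀ a, Algebra.TensorProduct.lid k carrier
      (Algebra.TensorProduct.map (Bialgebra.counitAlgHom k H) (AlgHom.id k carrier) (coact a)) = a

attribute [instance] LeftComoduleAlgebra.ring LeftComoduleAlgebra.algebra

namespace LeftComoduleAlgebra

variable {k H : Type u} [CommRing k] [Ring H] [Bialgebra k H]

instance : CoeSort (LeftComoduleAlgebra k H) (Type u) := ⟨carrier⟩

/-- The subalgebra of coinvariant elements: those `a` with `δ a = 1 ⊗ a`. -/
def coinvariants (A : LeftComoduleAlgebra k H) : Subalgebra k A :=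
  AlgHom.equalizer A.coact Algebra.TensorProduct.includeRight

/-- The canonical map `A ⊗ A → H ⊗ A`, `a ⊗ a' ↦ δ a * (1 ⊗ a')`. -/
def can (A : LeftComoduleAlgebra k H) : A ⊗[k] A →ₗ[k] H ⊗[k] A :=
  LinearMap.mul' k (H ⊗[k] A) ∘ₗ TensorProduct.map A.coact.toLinearMap
    (Algebra.TensorProduct.includeRight : (A : Type u) →ₐ[k] H ⊗[k] A).toLinearMap

/-- An isomorphism of `H`-comodule algebras exists between `A` and `B`. -/
def Isomorphic (A B : LeftComoduleAlgebra k H) : Prop :=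
  ∃ e : A ≃ₐ[k] B, ∀ a, B.coact (e a) =
    Algebra.TensorProduct.map (AlgHom.id k H) (e : (A : Type u) →ₐ[k] B) (A.coact a)

lemma Isomorphic.refl (A : LeftComoduleAlgebra k H) : A.Isomorphic A :=
  ⟨AlgEquiv.refl, fun a => by
    have : Algebra.TensorProduct.map (AlgHom.id k H)
        ((AlgEquiv.refl : A ≃ₐ[k] A) : (A : Type u) →ₐ[k] A) = AlgHom.id k _ := by
      ext <;> rfl
    rw [this]; rfl⟩

lemma Isomorphic.symm {A B : LeftComoduleAlgebra k H} (h : A.Isomorphic B) :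
    B.Isomorphic A := by
  obtain ⟨e, he⟩ := h
  refine ⟨e.symm, fun b => ?_⟩
  have h1 := he (e.symm b)
  rw [AlgEquiv.apply_symm_apply] at h1
  rw [h1, ← AlgHom.comp_apply, ← Algebra.TensorProduct.map_comp]
  have : Algebra.TensorProduct.map ((AlgHom.id k H).comp (AlgHom.id k H))
      ((e.symm : (B : Type u) →ₐ[k] A).comp (e : (A : Type u) →ₐ[k] B)) = AlgHom.id k _ := by
    ext <;> simp
  rw [this]; rfl

lemma Isomorphic.trans {A B C : LeftComoduleAlgebra k H} (h : A.Isomorphic B)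
    (h' : B.Isomorphic C) : A.Isomorphic C := by
  obtain ⟨e, he⟩ := h
  obtain ⟨f, hf⟩ := h'
  refine ⟨e.trans f, fun a => ?_⟩
  rw [AlgEquiv.trans_apply, hf, he, ← AlgHom.comp_apply, ← Algebra.TensorProduct.map_comp]
  rfl

/-- `A` is an `H`-Galois object: its subalgebra of coinvariants is `k`, its canonical map is
bijective, and it is faithfully flat over `k`. -/
structure IsGaloisObject (A : LeftComoduleAlgebra k H) : Prop where
  coinvariants_eq : A.coinvariants = ⊥
  bijective_can : Function.Bijective A.can
  faithfullyFlat : Module.FaithfullyFlat k A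

/-- Corestriction of the coaction along a morphism of bialgebras. -/
def corestrict {H' : Type u} [Ring H'] [Bialgebra k H'] (f : H →ₐc[k] H')
    (A : LeftComoduleAlgebra k H) : LeftComoduleAlgebra k H' where
  carrier := A
  coact := (Algebra.TensorProduct.map (f : H →ₐ[k] H') (AlgHom.id k A)).comp A.coact
  coassoc a := by
    have h1 := congrArg (Algebra.TensorProduct.map (f : H →ₐ[k] H')
      (Algebra.TensorProduct.map (f : H →ₐ[k] H') (AlgHom.id k A))) (A.coassoc a)
    have key1 : ∀ w : H ⊗[k] A, Algebra.TensorProduct.assoc k k k H' H' A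
        (Algebra.TensorProduct.map (Bialgebra.comulAlgHom k H') (AlgHom.id k A)
          (Algebra.TensorProduct.map (f : H →ₐ[k] H') (AlgHom.id k A) w)) =
        Algebra.TensorProduct.map (f : H →ₐ[k] H')
          (Algebra.TensorProduct.map (f : H →ₐ[k] H') (AlgHom.id k A))
          (Algebra.TensorProduct.assoc k k k H H A
            (Algebra.TensorProduct.map (Bialgebra.comulAlgHom k H) (AlgHom.id k A) w)) := by
      intro w
      induction w with
      | zero => simp
      | add x y hx hy => simp only [map_add, hx, hy]
      | tmul h a =>
        have hf : Coalgebra.comul (R := k) (f h) =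
            TensorProduct.map (f : H →ₗ[k] H') (f : H →ₗ[k] H') (Coalgebra.comul (R := k) h) :=
          (CoalgHomClass.map_comp_comul_apply f h).symm
        simp only [Algebra.TensorProduct.map_tmul, Bialgebra.comulAlgHom_apply, AlgHom.id_apply,
          BialgHom.coe_toAlgHom, hf]
        induction Coalgebra.comul (R := k) h with
        | zero => simp
        | add x y hx hy => simp only [map_add, TensorProduct.add_tmul, hx, hy]
        | tmul x y => simp
    have key2 : ∀ w : H ⊗[k] A, Algebra.TensorProduct.map (AlgHom.id k H')
          ((Algebra.TensorProduct.map (f : H →ₐ[k] H') (AlgHom.id k A)).comp A.coact)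
          (Algebra.TensorProduct.map (f : H →ₐ[k] H') (AlgHom.id k A) w) =
        Algebra.TensorProduct.map (f : H →ₐ[k] H')
          (Algebra.TensorProduct.map (f : H →ₐ[k] H') (AlgHom.id k A))
          (Algebra.TensorProduct.map (AlgHom.id k H) A.coact w) := by
      intro w
      induction w with
      | zero => simp
      | add x y hx hy => simp only [map_add, hx, hy]
      | tmul h a => simp
    rw [AlgHom.comp_apply, key1, key2, h1]
  counit a := by
    have key : ∀ w : H ⊗[k] A, Algebra.TensorProduct.lid k A
        (Algebra.TensorProduct.map (Bialgebra.counitAlgHom k H') (AlgHom.id k A)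
          (Algebra.TensorProduct.map (f : H →ₐ[k] H') (AlgHom.id k A) w)) =
        Algebra.TensorProduct.lid k A
          (Algebra.TensorProduct.map (Bialgebra.counitAlgHom k H) (AlgHom.id k A) w) := by
      intro w
      induction w with
      | zero => simp
      | add x y hx hy => simp only [map_add, hx, hy]
      | tmul h a => simp
    rw [AlgHom.comp_apply, key, A.counit]

/-- The coaction of the base change: `S ⊗ A → S ⊗ (H ⊗ A) = (S ⊗ H) ⊗_S (S ⊗ A)`,
`s ⊗ a ↦ (s ⊗ a₍₋₁₎) ⊗ (1 ⊗ a₍₀₎)`. -/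
def baseChangeCoact (S : Type u) [CommRing S] [Algebra k S] (A : LeftComoduleAlgebra k H) :
    S ⊗[k] A →ₐ[S] (S ⊗[k] H) ⊗[S] (S ⊗[k] A) :=
  (Algebra.TensorProduct.tensorTensorTensorComm k S k S S S H A).toAlgHom.comp
    (Algebra.TensorProduct.map (Bialgebra.comulAlgHom S S) A.coact)

/-- The `k`-linear map `H ⊗ A → (S ⊗ H) ⊗_S (S ⊗ A)`. -/
def baseChangeAux (S : Type u) [CommRing S] [Algebra k S] (B C : Type u) [Ring B] [Algebra k B]
    [Ring C] [Algebra k C] : B ⊗[k] C →ₐ[k] (S ⊗[k] B) ⊗[S] (S ⊗[k] C) :=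
  ((Algebra.TensorProduct.tensorTensorTensorComm k S k S S S B C).toAlgHom.restrictScalars
    k).comp Algebra.TensorProduct.includeRight

lemma baseChangeAux_tmul (S : Type u) [CommRing S] [Algebra k S] (B C : Type u) [Ring B]
    [Algebra k B] [Ring C] [Algebra k C] (b : B) (c : C) :
    baseChangeAux S B C (b ⊗ₜ[k] c) = ((1 : S) ⊗ₜ[k] b) ⊗ₜ[S] ((1 : S) ⊗ₜ[k] c) := rfl

lemma baseChangeCoact_one_tmul (S : Type u) [CommRing S] [Algebra k S]
    (A : LeftComoduleAlgebra k H) (a : A) :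
    A.baseChangeCoact S (1 ⊗ₜ a) = baseChangeAux S H A (A.coact a) := by
  simp [baseChangeCoact, baseChangeAux, Algebra.TensorProduct.one_def]

/-- The base change of a left `H`-comodule algebra over `k` along `k → S` is a left
`S ⊗ H`-comodule algebra over `S`. -/
def baseChange (S : Type u) [CommRing S] [Algebra k S] (A : LeftComoduleAlgebra k H) :
    LeftComoduleAlgebra S (S ⊗[k] H) where
  carrier := S ⊗[k] A
  coact := A.baseChangeCoact S
  coassoc a := by
    suffices h : ((Algebra.TensorProduct.assoc S S S (S ⊗[k] H) (S ⊗[k] H)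
          (S ⊗[k] A)).toAlgHom.comp (Algebra.TensorProduct.map
          (Bialgebra.comulAlgHom S (S ⊗[k] H)) (AlgHom.id S (S ⊗[k] A)))).comp
          (A.baseChangeCoact S) = (Algebra.TensorProduct.map (AlgHom.id S (S ⊗[k] H))
          (A.baseChangeCoact S)).comp (A.baseChangeCoact S) from DFunLike.congr_fun h a
    apply Algebra.TensorProduct.ext
    · ext
    · ext a
      let L : H ⊗[k] (H ⊗[k] A) →ₗ[k] (S ⊗[k] H) ⊗[S] ((S ⊗[k] H) ⊗[S] (S ⊗[k] A)) :=
        TensorProduct.lift (LinearMap.mk₂ k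
          (fun h w => ((1 : S) ⊗ₜ[k] h) ⊗ₜ[S] baseChangeAux S H A w)
          (fun _ _ _ => by simp only [TensorProduct.tmul_add, TensorProduct.add_tmul])
          (fun _ _ _ => by
            simp only [TensorProduct.tmul_smul, TensorProduct.smul_tmul'])
          (fun _ _ _ => by simp only [map_add, TensorProduct.tmul_add])
          (fun _ _ _ => by simp only [map_smul, TensorProduct.tmul_smul]))
      have hL : ∀ h w, L (h ⊗ₜ w) = ((1 : S) ⊗ₜ[k] h) ⊗ₜ[S] baseChangeAux S H A w :=
        fun _ _ => rfl
      have key1 : ∀ w : H ⊗[k] A, Algebra.TensorProduct.assoc S S S (S ⊗[k] H) (S ⊗[k] H) (S ⊗[k] A)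
          (Algebra.TensorProduct.map (Bialgebra.comulAlgHom S (S ⊗[k] H))
            (AlgHom.id S (S ⊗[k] A)) (baseChangeAux S H A w)) =
          L (Algebra.TensorProduct.assoc k k k H H A
            (Algebra.TensorProduct.map (Bialgebra.comulAlgHom k H) (AlgHom.id k A) w)) := by
        intro w
        induction w with
        | zero => simp
        | add x y hx hy => simp only [map_add, hx, hy]
        | tmul h a =>
          simp only [baseChangeAux_tmul, Algebra.TensorProduct.map_tmul, AlgHom.id_apply,
            Bialgebra.comulAlgHom_apply, TensorProduct.comul_tmul, CommSemiring.comul_apply]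
          induction Coalgebra.comul (R := k) h with
          | zero => simp
          | add x y hx hy => simp only [map_add, TensorProduct.add_tmul, TensorProduct.tmul_add,
              hx, hy]
          | tmul x y => simp [hL, baseChangeAux_tmul]
      have key2 : ∀ w : H ⊗[k] A, Algebra.TensorProduct.map (AlgHom.id S (S ⊗[k] H))
          (A.baseChangeCoact S) (baseChangeAux S H A w) =
          L (Algebra.TensorProduct.map (AlgHom.id k H) A.coact w) := by
        intro w
        induction w with
        | zero => simp
        | add x y hx hy => simp only [map_add, hx, hy]
        | tmul h a => simp [hL, baseChangeAux_tmul, baseChangeCoact_one_tmul]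
      have h1 := congrArg L (A.coassoc a)
      rw [← key1, ← key2, ← baseChangeCoact_one_tmul] at h1
      exact h1
  counit a := by
    suffices h : ((Algebra.TensorProduct.lid S (S ⊗[k] A)).toAlgHom.comp
          (Algebra.TensorProduct.map (Bialgebra.counitAlgHom S (S ⊗[k] H))
          (AlgHom.id S (S ⊗[k] A)))).comp
          (A.baseChangeCoact S) = AlgHom.id S (S ⊗[k] A) from DFunLike.congr_fun h a
    apply Algebra.TensorProduct.ext
    · ext
    · ext a
      have key : ∀ w : H ⊗[k] A, Algebra.TensorProduct.lid S (S ⊗[k] A)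
          (Algebra.TensorProduct.map (Bialgebra.counitAlgHom S (S ⊗[k] H))
          (AlgHom.id S (S ⊗[k] A)) (baseChangeAux S H A w)) =
          1 ⊗ₜ[k] Algebra.TensorProduct.lid k A
          (Algebra.TensorProduct.map (Bialgebra.counitAlgHom k H) (AlgHom.id k A) w) := by
        intro w
        induction w with
        | zero => simp
        | add x y hx hy => simp only [map_add, hx, hy, TensorProduct.tmul_add]
        | tmul h a =>
          simp [baseChangeAux_tmul]
      have h2 := key (A.coact a)
      rw [A.counit, ← baseChangeCoact_one_tmul] at h2
      exact h2


section Retract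

variable (R : Type u) [CommRing R] [Algebra k R] [Algebra R k] [IsScalarTower k R k]

/-- The canonical identification of `k ⊗_R (R ⊗ H)` with `H`, `x ⊗ (r ⊗ h) ↦ (r • x) • h`,
for a `k`-algebra `R` and a `k`-algebra morphism `R → k`. -/
def retractLinear (H : Type u) [Ring H] [Bialgebra k H] : k ⊗[R] (R ⊗[k] H) ≃ₗ[k] H :=
  (TensorProduct.AlgebraTensorModule.cancelBaseChange k R k k H).trans (TensorProduct.lid k H)

variable (H : Type u) [Ring H] [Bialgebra k H]

set_option linter.unusedSectionVars false

lemma retractLinear_tmul (x : k) (r : R) (h : H) :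
    retractLinear R H (x ⊗ₜ[R] (r ⊗ₜ[k] h)) = (r • x) • h := rfl

lemma retract_ext {C : Type u} [AddCommGroup C] [Module k C]
    (f g : k ⊗[R] (R ⊗[k] H) →ₗ[k] C)
    (hfg : ∀ h : H, f ((1 : k) ⊗ₜ ((1 : R) ⊗ₜ h)) = g ((1 : k) ⊗ₜ ((1 : R) ⊗ₜ h))) : f = g := by
  ext x
  induction x with
  | zero => simp
  | add x y hx hy => simp only [map_add, hx, hy]
  | tmul r w =>
    induction w with
    | zero => simp
    | add x y hx hy => simp only [map_add, TensorProduct.tmul_add, hx, hy]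
    | tmul p h =>
      have h1 : p ⊗ₜ[k] h = p • ((1 : R) ⊗ₜ[k] h) := by
        rw [TensorProduct.smul_tmul', smul_eq_mul, mul_one]
      have h2 : r ⊗ₜ[R] (p ⊗ₜ[k] h) = (p • r) • ((1 : k) ⊗ₜ[R] ((1 : R) ⊗ₜ[k] h)) := by
        rw [h1, ← TensorProduct.smul_tmul, TensorProduct.smul_tmul', smul_eq_mul, mul_one]
      rw [h2, map_smul, map_smul, hfg]

lemma retractLinear_mul (x y : k ⊗[R] (R ⊗[k] H)) :
    retractLinear R H (x * y) = retractLinear R H x * retractLinear R H y := by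
  have key : ∀ (h : H) (y : k ⊗[R] (R ⊗[k] H)),
      retractLinear R H (((1 : k) ⊗ₜ ((1 : R) ⊗ₜ h)) * y) = h * retractLinear R H y := by
    intro h y
    refine DFunLike.congr_fun (retract_ext R H
      ((retractLinear R H).toLinearMap ∘ₗ
        LinearMap.mulLeft k ((1 : k) ⊗ₜ[R] ((1 : R) ⊗ₜ[k] h)))
      (LinearMap.mulLeft k h ∘ₗ (retractLinear R H).toLinearMap) fun h' => ?_) y
    simp [Algebra.TensorProduct.tmul_mul_tmul, retractLinear_tmul]
  refine DFunLike.congr_fun (retract_ext R H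
      ((retractLinear R H).toLinearMap ∘ₗ LinearMap.mulRight k y)
      (LinearMap.mulRight k (retractLinear R H y) ∘ₗ (retractLinear R H).toLinearMap)
      fun h => ?_) x
  simp [key, retractLinear_tmul]

set_option synthInstance.maxHeartbeats 200000 in
/-- The same identification as a morphism of bialgebras. -/
def retractBialgHom : k ⊗[R] (R ⊗[k] H) →ₐc[k] H :=
  BialgHom.ofAlgHom (AlgHom.ofLinearMap (retractLinear R H).toLinearMap
      (by
        change retractLinear R H ((1 : k) ⊗ₜ ((1 : R) ⊗ₜ (1 : H))) = 1
        simp [retractLinear_tmul])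
      (retractLinear_mul R H))
    (by
      apply AlgHom.toLinearMap_injective
      apply retract_ext
      intro h
      simp [retractLinear_tmul])
    (by
      apply AlgHom.toLinearMap_injective
      apply retract_ext
      intro h
      simp only [AlgHom.toLinearMap_apply, AlgHom.comp_apply, Bialgebra.comulAlgHom_apply,
        TensorProduct.comul_tmul, CommSemiring.comul_apply, AlgHom.ofLinearMap_apply,
        LinearEquiv.coe_coe, retractLinear_tmul, one_smul]
      induction Coalgebra.comul (R := k) h with
      | zero => simp
      | add x y hx hy => simp only [map_add, TensorProduct.tmul_add, hx, hy]
      | tmul x y => simp [retractLinear_tmul])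

end Retract

/-- The base change of a left `R ⊗ H`-comodule algebra over `R` along `R → k`, as a left
`H`-comodule algebra over `k`. -/
def retract {R : Type u} [CommRing R] [Algebra k R] [Algebra R k] [IsScalarTower k R k]
    (A : LeftComoduleAlgebra R (R ⊗[k] H)) : LeftComoduleAlgebra k H :=
  (A.baseChange k).corestrict (retractBialgHom R H)

/-- Evaluation at `c`: the ring `k` as a `k[t]`-algebra via `t ↦ c`. -/
abbrev evalAlgebra (c : k) : Algebra k[X] k := (Polynomial.evalRingHom c).toAlgebra

lemma evalAlgebra_isScalarTower (c : k) :
    letI := evalAlgebra c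
    IsScalarTower k k[X] k :=
  letI := evalAlgebra c
  .of_algebraMap_eq fun x => (Polynomial.eval_C (a := x) (x := c)).symm

/-- The map `[c]_*`: the base change of a left `H[t]`-comodule algebra over `k[t]` along the
evaluation `k[t] → k` at `t = c`, as a left `H`-comodule algebra over `k`.  Here
`H[t] = k[t] ⊗ H`, and `k ⊗_{k[t]} H[t]` is identified with `H`. -/
def specialize (c : k) (A : LeftComoduleAlgebra k[X] (k[X] ⊗[k] H)) : LeftComoduleAlgebra k H :=
  letI := evalAlgebra c
  haveI := evalAlgebra_isScalarTower c
  A.retract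

end LeftComoduleAlgebra

/-- If there is an `H`-Galois object, then `H` is flat over `k`. -/
lemma LeftComoduleAlgebra.IsGaloisObject.flat {k H : Type u} [CommRing k] [Ring H]
    [Bialgebra k H] {A : LeftComoduleAlgebra k H} (hA : A.IsGaloisObject) : Module.Flat k H := by
  have := hA.faithfullyFlat
  let e : A ⊗[k] A ≃ₗ[k] A ⊗[k] H :=
    (LinearEquiv.ofBijective A.can hA.bijective_can).trans (TensorProduct.comm k H A)
  have : Module.Flat k (A ⊗[k] H) := Module.Flat.of_linearEquiv e.symm
  rw [Module.Flat.iff_lTensor_preserves_injective_linearMap]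
  intro N P _ _ _ _ f hf
  rw [← Module.FaithfullyFlat.lTensor_injective_iff_injective k A]
  have h1 := Module.Flat.lTensor_preserves_injective_linearMap (M := A ⊗[k] H) f hf
  rw [LinearMap.lTensor_tensor] at h1
  simpa using h1

/-- An `H`-`K`-bicomodule algebra: a left `H`-comodule algebra which is also a right
`K`-comodule algebra, the two coactions commuting. -/
structure BicomoduleAlgebra (k H K : Type u) [CommRing k] [Ring H] [Bialgebra k H] [Ring K]
    [Bialgebra k K] extends LeftComoduleAlgebra k H where
  /-- the right coaction -/
  rcoact : carrier →ₐ[k] carrier ⊗[k] K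
  rcoassoc : ∀ z, Algebra.TensorProduct.assoc k k k carrier K K
      (Algebra.TensorProduct.map rcoact (AlgHom.id k K) (rcoact z)) =
    Algebra.TensorProduct.map (AlgHom.id k carrier) (Bialgebra.comulAlgHom k K) (rcoact z)
  rcounit : ∀ z, Algebra.TensorProduct.rid k k carrier
      (Algebra.TensorProduct.map (AlgHom.id k carrier) (Bialgebra.counitAlgHom k K)
        (rcoact z)) = z
  coact_rcoact : ∀ z, Algebra.TensorProduct.assoc k k k H carrier K
      (Algebra.TensorProduct.map coact (AlgHom.id k K) (rcoact z)) =
    Algebra.TensorProduct.map (AlgHom.id k H) rcoact (coact z)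

namespace BicomoduleAlgebra

variable {k H K : Type u} [CommRing k] [Ring H] [Bialgebra k H] [Ring K] [Bialgebra k K]

/-- The subalgebra of right coinvariant elements: those `z` with `ρ z = z ⊗ 1`. -/
def rcoinvariants (Z : BicomoduleAlgebra k H K) : Subalgebra k Z.carrier :=
  AlgHom.equalizer Z.rcoact Algebra.TensorProduct.includeLeft

/-- The right canonical map `Z ⊗ Z → Z ⊗ K`, `z ⊗ z' ↦ (z ⊗ 1) * ρ z'`. -/
def rcan (Z : BicomoduleAlgebra k H K) : Z.carrier ⊗[k] Z.carrier →ₗ[k] Z.carrier ⊗[k] K :=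
  LinearMap.mul' k (Z.carrier ⊗[k] K) ∘ₗ TensorProduct.map
    (Algebra.TensorProduct.includeLeft : Z.carrier →ₐ[k] Z.carrier ⊗[k] K).toLinearMap
    Z.rcoact.toLinearMap

/-- `Z` is an `H`-`K`-bi-Galois object: it is a left `H`-Galois object and a right `K`-Galois
object (faithful flatness over `k` is part of the first field). -/
structure IsBiGaloisObject (Z : BicomoduleAlgebra k H K) : Prop where
  left : Z.toLeftComoduleAlgebra.IsGaloisObject
  rcoinvariants_eq : Z.rcoinvariants = ⊥
  bijective_rcan : Function.Bijective Z.rcan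

variable (Z : BicomoduleAlgebra k H K) (A : LeftComoduleAlgebra k K)

/-- `id ⊗ δ_A : Z ⊗ A → Z ⊗ (K ⊗ A)`. -/
def idCoact : Z.carrier ⊗[k] A →ₐ[k] Z.carrier ⊗[k] (K ⊗[k] A) :=
  Algebra.TensorProduct.map (AlgHom.id k Z.carrier) A.coact

/-- `ρ_Z ⊗ id : Z ⊗ A → Z ⊗ (K ⊗ A)`. -/
def rcoactId : Z.carrier ⊗[k] A →ₐ[k] Z.carrier ⊗[k] (K ⊗[k] A) :=
  (Algebra.TensorProduct.assoc k k k Z.carrier K A).toAlgHom.comp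
    (Algebra.TensorProduct.map Z.rcoact (AlgHom.id k A))

/-- The cotensor product `Z □_K A`, as a subalgebra of `Z ⊗ A`: the equalizer of the coactions
of `Z` and `A`. -/
def cotensorSubalgebra : Subalgebra k (Z.carrier ⊗[k] A) :=
  AlgHom.equalizer (Z.rcoactId A) (Z.idCoact A)

/-- `δ_Z ⊗ id : Z ⊗ A → H ⊗ (Z ⊗ A)`. -/
def coactId : Z.carrier ⊗[k] A →ₐ[k] H ⊗[k] (Z.carrier ⊗[k] A) :=
  (Algebra.TensorProduct.assoc k k k H Z.carrier A).toAlgHom.comp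
    (Algebra.TensorProduct.map Z.coact (AlgHom.id k A))

/-- The inclusion `H ⊗ (Z □_K A) → H ⊗ (Z ⊗ A)`. -/
def cotensorIncl : H ⊗[k] Z.cotensorSubalgebra A →ₐ[k] H ⊗[k] (Z.carrier ⊗[k] A) :=
  Algebra.TensorProduct.map (AlgHom.id k H) (Z.cotensorSubalgebra A).val

lemma cotensorIncl_injective (hH : Module.Flat k H) : Function.Injective (Z.cotensorIncl A) :=
  Module.Flat.lTensor_preserves_injective_linearMap (M := H)
    (Z.cotensorSubalgebra A).val.toLinearMap Subtype.val_injective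

/-- `δ_Z ⊗ id : Z ⊗ (K ⊗ A) → H ⊗ (Z ⊗ (K ⊗ A))`. -/
def coactIdId : Z.carrier ⊗[k] (K ⊗[k] A) →ₐ[k] H ⊗[k] (Z.carrier ⊗[k] (K ⊗[k] A)) :=
  (Algebra.TensorProduct.assoc k k k H Z.carrier (K ⊗[k] A)).toAlgHom.comp
    (Algebra.TensorProduct.map Z.coact (AlgHom.id k (K ⊗[k] A)))

lemma coactIdId_idCoact (x : Z.carrier ⊗[k] A) :
    Z.coactIdId A (Z.idCoact A x) =
      Algebra.TensorProduct.map (AlgHom.id k H) (Z.idCoact A) (Z.coactId A x) := by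
  induction x with
  | zero => simp only [map_zero]
  | add x y hx hy => simp only [map_add, hx, hy]
  | tmul z a =>
    simp only [idCoact, coactIdId, coactId, AlgHom.comp_apply, Algebra.TensorProduct.map_tmul,
      AlgHom.id_apply]
    induction Z.coact z with
    | zero => simp only [map_zero, TensorProduct.zero_tmul]
    | add x y hx hy => simp only [map_add, TensorProduct.add_tmul, hx, hy]
    | tmul h z' => simp

lemma coactIdId_rcoactId (x : Z.carrier ⊗[k] A) :
    Z.coactIdId A (Z.rcoactId A x) =
      Algebra.TensorProduct.map (AlgHom.id k H) (Z.rcoactId A) (Z.coactId A x) := by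
  induction x with
  | zero => simp only [map_zero]
  | add x y hx hy => simp only [map_add, hx, hy]
  | tmul z a =>
    let N : H ⊗[k] (Z.carrier ⊗[k] K) →ₗ[k] H ⊗[k] (Z.carrier ⊗[k] (K ⊗[k] A)) :=
      LinearMap.lTensor H ((TensorProduct.assoc k Z.carrier K A).toLinearMap ∘ₗ
        (TensorProduct.mk k (Z.carrier ⊗[k] K) A).flip a)
    have key1 : ∀ w : Z.carrier ⊗[k] K, Z.coactIdId A
        (Algebra.TensorProduct.assoc k k k Z.carrier K A (w ⊗ₜ a)) =
        N (Algebra.TensorProduct.assoc k k k H Z.carrier K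
          (Algebra.TensorProduct.map Z.coact (AlgHom.id k K) w)) := by
      intro w
      induction w with
      | zero => simp only [map_zero, TensorProduct.zero_tmul]
      | add x y hx hy => simp only [map_add, TensorProduct.add_tmul, hx, hy]
      | tmul z' x =>
        simp only [coactIdId, AlgHom.comp_apply, Algebra.TensorProduct.assoc_tmul,
          AlgEquiv.toAlgHom_apply, Algebra.TensorProduct.map_tmul, AlgHom.id_apply]
        induction Z.coact z' with
        | zero => simp only [map_zero, TensorProduct.zero_tmul]
        | add x y hx hy => simp only [map_add, TensorProduct.add_tmul, hx, hy]
        | tmul h z'' => simp [N]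
    have key2 : ∀ w : H ⊗[k] Z.carrier,
        Algebra.TensorProduct.map (AlgHom.id k H) (Z.rcoactId A)
          (Algebra.TensorProduct.assoc k k k H Z.carrier A (w ⊗ₜ a)) =
        N (Algebra.TensorProduct.map (AlgHom.id k H) Z.rcoact w) := by
      intro w
      induction w with
      | zero => simp only [map_zero, TensorProduct.zero_tmul]
      | add x y hx hy => simp only [map_add, TensorProduct.add_tmul, hx, hy]
      | tmul h z' => simp [N, rcoactId]; rfl
    exact (key1 (Z.rcoact z)).trans ((congrArg N (Z.coact_rcoact z)).trans
      (key2 (Z.coact z)).symm)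

lemma coactId_mem_range (hH : Module.Flat k H) (x : Z.cotensorSubalgebra A) :
    Z.coactId A x ∈ (Z.cotensorIncl A).range := by
  let D : Z.carrier ⊗[k] A →ₗ[k] Z.carrier ⊗[k] (K ⊗[k] A) :=
    (Z.rcoactId A).toLinearMap - (Z.idCoact A).toLinearMap
  have hex : Function.Exact (Z.cotensorSubalgebra A).val.toLinearMap D := by
    intro y
    constructor
    · intro hy
      exact ⟨⟨y, sub_eq_zero.mp hy⟩, rfl⟩
    · rintro ⟨⟨y, hy⟩, rfl⟩
      exact sub_eq_zero.mpr hy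
  have hex' := Module.Flat.lTensor_exact H hex
  have h0 : LinearMap.lTensor H D (Z.coactId A x) = 0 := by
    rw [LinearMap.lTensor_sub, LinearMap.sub_apply, sub_eq_zero]
    have h1 := Z.coactIdId_rcoactId A x
    have h2 : Z.rcoactId A x = Z.idCoact A x := x.2
    rw [h2, Z.coactIdId_idCoact A x] at h1
    exact h1.symm
  obtain ⟨y, hy⟩ := (hex' _).mp h0
  exact ⟨y, hy⟩

/-- The left `H`-coaction of the cotensor product `Z □_K A` for flat `H`: the restriction of
`δ_Z ⊗ id`, with values in `H ⊗ (Z □_K A) ⊆ H ⊗ (Z ⊗ A)`. -/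
def cotensorCoact (hH : Module.Flat k H) :
    Z.cotensorSubalgebra A →ₐ[k] H ⊗[k] Z.cotensorSubalgebra A :=
  (AlgEquiv.ofInjective (Z.cotensorIncl A) (Z.cotensorIncl_injective A hH)).symm.toAlgHom.comp
    (((Z.coactId A).comp (Z.cotensorSubalgebra A).val).codRestrict _
      (Z.coactId_mem_range A hH))

lemma cotensorIncl_cotensorCoact (hH : Module.Flat k H) (x : Z.cotensorSubalgebra A) :
    Z.cotensorIncl A (Z.cotensorCoact A hH x) = Z.coactId A x :=
  congrArg Subtype.val (AlgEquiv.apply_symm_apply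
    (AlgEquiv.ofInjective (Z.cotensorIncl A) (Z.cotensorIncl_injective A hH))
    ⟨Z.coactId A x, Z.coactId_mem_range A hH x⟩)

lemma coactId_coassoc (y : Z.carrier ⊗[k] A) :
    Algebra.TensorProduct.assoc k k k H H (Z.carrier ⊗[k] A)
      (Algebra.TensorProduct.map (Bialgebra.comulAlgHom k H)
        (AlgHom.id k (Z.carrier ⊗[k] A)) (Z.coactId A y)) =
    Algebra.TensorProduct.map (AlgHom.id k H) (Z.coactId A) (Z.coactId A y) := by
  induction y with
  | zero => simp only [map_zero]
  | add x y hx hy => simp only [map_add, hx, hy]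
  | tmul z a =>
    let N : H ⊗[k] (H ⊗[k] Z.carrier) →ₗ[k] H ⊗[k] (H ⊗[k] (Z.carrier ⊗[k] A)) :=
      LinearMap.lTensor H ((TensorProduct.assoc k H Z.carrier A).toLinearMap ∘ₗ
        (TensorProduct.mk k (H ⊗[k] Z.carrier) A).flip a)
    have key1 : ∀ w : H ⊗[k] Z.carrier, Algebra.TensorProduct.assoc k k k H H (Z.carrier ⊗[k] A)
        (Algebra.TensorProduct.map (Bialgebra.comulAlgHom k H) (AlgHom.id k (Z.carrier ⊗[k] A))
          (Algebra.TensorProduct.assoc k k k H Z.carrier A (w ⊗ₜ a))) =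
        N (Algebra.TensorProduct.assoc k k k H H Z.carrier
          (Algebra.TensorProduct.map (Bialgebra.comulAlgHom k H) (AlgHom.id k Z.carrier) w)) := by
      intro w
      induction w with
      | zero => simp only [map_zero, TensorProduct.zero_tmul]
      | add x y hx hy => simp only [map_add, TensorProduct.add_tmul, hx, hy]
      | tmul h z' =>
        simp only [Algebra.TensorProduct.assoc_tmul, Algebra.TensorProduct.map_tmul,
          Bialgebra.comulAlgHom_apply, AlgHom.id_apply]
        induction Coalgebra.comul (R := k) h with
        | zero => simp only [map_zero, TensorProduct.zero_tmul]
        | add x y hx hy => simp only [map_add, TensorProduct.add_tmul, hx, hy]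
        | tmul h h' => simp [N]
    have key2 : ∀ w : H ⊗[k] Z.carrier,
        Algebra.TensorProduct.map (AlgHom.id k H) (Z.coactId A)
          (Algebra.TensorProduct.assoc k k k H Z.carrier A (w ⊗ₜ a)) =
        N (Algebra.TensorProduct.map (AlgHom.id k H) Z.coact w) := by
      intro w
      induction w with
      | zero => simp only [map_zero, TensorProduct.zero_tmul]
      | add x y hx hy => simp only [map_add, TensorProduct.add_tmul, hx, hy]
      | tmul h z' => simp [N, coactId]; rfl
    exact (key1 (Z.coact z)).trans ((congrArg N (Z.coassoc z)).trans (key2 (Z.coact z)).symm)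

/-- The cotensor product `Z □_K A` as a left `H`-comodule algebra, for flat `H`. -/
def cotensor (hH : Module.Flat k H) : LeftComoduleAlgebra k H where
  carrier := Z.cotensorSubalgebra A
  coact := Z.cotensorCoact A hH
  coassoc x := by
    have hinj : Function.Injective (LinearMap.lTensor H (Z.cotensorIncl A).toLinearMap) :=
      Module.Flat.lTensor_preserves_injective_linearMap _ (Z.cotensorIncl_injective A hH)
    apply hinj
    have key1 : ∀ w : H ⊗[k] Z.cotensorSubalgebra A,
        LinearMap.lTensor H (Z.cotensorIncl A).toLinearMap
          (Algebra.TensorProduct.assoc k k k H H (Z.cotensorSubalgebra A)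
            (Algebra.TensorProduct.map (Bialgebra.comulAlgHom k H)
              (AlgHom.id k (Z.cotensorSubalgebra A)) w)) =
        Algebra.TensorProduct.assoc k k k H H (Z.carrier ⊗[k] A)
          (Algebra.TensorProduct.map (Bialgebra.comulAlgHom k H)
            (AlgHom.id k (Z.carrier ⊗[k] A)) (Z.cotensorIncl A w)) := by
      intro w
      induction w with
      | zero => simp only [map_zero]
      | add x y hx hy => simp only [map_add, hx, hy]
      | tmul h y =>
        simp only [cotensorIncl, Algebra.TensorProduct.map_tmul, Bialgebra.comulAlgHom_apply,
          AlgHom.id_apply]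
        induction Coalgebra.comul (R := k) h with
        | zero => simp only [map_zero, TensorProduct.zero_tmul]
        | add x y hx hy => simp only [map_add, TensorProduct.add_tmul, hx, hy]
        | tmul h h' => simp
    have key2 : ∀ w : H ⊗[k] Z.cotensorSubalgebra A,
        LinearMap.lTensor H (Z.cotensorIncl A).toLinearMap
          (Algebra.TensorProduct.map (AlgHom.id k H) (Z.cotensorCoact A hH) w) =
        Algebra.TensorProduct.map (AlgHom.id k H) (Z.coactId A) (Z.cotensorIncl A w) := by
      intro w
      induction w with
      | zero => simp only [map_zero]
      | add x y hx hy => simp only [map_add, hx, hy]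
      | tmul h y =>
        have h1 := Z.cotensorIncl_cotensorCoact A hH y
        simp only [Algebra.TensorProduct.map_tmul, AlgHom.id_apply, LinearMap.lTensor_tmul,
          AlgHom.toLinearMap_apply, h1]
        simp [cotensorIncl]
    rw [key1, key2, cotensorIncl_cotensorCoact, coactId_coassoc]
  counit x := by
    apply Subtype.val_injective
    have key : ∀ w : H ⊗[k] Z.cotensorSubalgebra A,
        ((Algebra.TensorProduct.lid k (Z.cotensorSubalgebra A)
          (Algebra.TensorProduct.map (Bialgebra.counitAlgHom k H)
            (AlgHom.id k (Z.cotensorSubalgebra A)) w) : Z.cotensorSubalgebra A) :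
            Z.carrier ⊗[k] A) =
        Algebra.TensorProduct.lid k (Z.carrier ⊗[k] A)
          (Algebra.TensorProduct.map (Bialgebra.counitAlgHom k H)
            (AlgHom.id k (Z.carrier ⊗[k] A)) (Z.cotensorIncl A w)) := by
      intro w
      induction w with
      | zero => simp only [map_zero, ZeroMemClass.coe_zero]
      | add x y hx hy => simp only [map_add, hx, hy, AddMemClass.coe_add]
      | tmul h z' => simp [cotensorIncl]
    have key2 : ∀ y : Z.carrier ⊗[k] A, Algebra.TensorProduct.lid k (Z.carrier ⊗[k] A)
          (Algebra.TensorProduct.map (Bialgebra.counitAlgHom k H)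
            (AlgHom.id k (Z.carrier ⊗[k] A)) (Z.coactId A y)) = y := by
      intro y
      induction y with
      | zero => simp only [map_zero]
      | add x y hx hy => simp only [map_add, hx, hy]
      | tmul z a =>
        have h1 : ∀ w : H ⊗[k] Z.carrier, Algebra.TensorProduct.lid k (Z.carrier ⊗[k] A)
          (Algebra.TensorProduct.map (Bialgebra.counitAlgHom k H)
            (AlgHom.id k (Z.carrier ⊗[k] A))
            (Algebra.TensorProduct.assoc k k k H Z.carrier A (w ⊗ₜ a))) =
            (Algebra.TensorProduct.lid k Z.carrier (Algebra.TensorProduct.map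
              (Bialgebra.counitAlgHom k H) (AlgHom.id k Z.carrier) w)) ⊗ₜ a := by
          intro w
          induction w with
          | zero => simp only [map_zero, TensorProduct.zero_tmul]
          | add x y hx hy => simp only [map_add, TensorProduct.add_tmul, hx, hy]
          | tmul h z' => simp [TensorProduct.smul_tmul']
        have h2 := h1 (Z.coact z)
        rw [Z.counit] at h2
        exact h2
    rw [key, cotensorIncl_cotensorCoact, key2]

end BicomoduleAlgebra

/-- The left `K`-Galois objects over `k`. -/
abbrev GaloisObject (k K : Type u) [CommRing k] [Ring K] [HopfAlgebra k K] : Type (u + 1) :=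
  {A : LeftComoduleAlgebra k K // A.IsGaloisObject}

/-- Isomorphism of Galois objects. -/
instance GaloisObject.setoid (k K : Type u) [CommRing k] [Ring K] [HopfAlgebra k K] :
    Setoid (GaloisObject k K) where
  r A B := A.1.Isomorphic B.1
  iseqv := ⟨fun _ => .refl _, fun h => h.symm, fun h h' => h.trans h'⟩

/-- `Gal_k(K)`: the isomorphism classes of left `K`-Galois objects. -/
def Gal (k K : Type u) [CommRing k] [Ring K] [HopfAlgebra k K] : Type (u + 1) :=
  Quotient (GaloisObject.setoid k K)

/-- The isomorphism class of a Galois object. -/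
def Gal.mk {k K : Type u} [CommRing k] [Ring K] [HopfAlgebra k K] (A : GaloisObject k K) :
    Gal k K :=
  Quotient.mk _ A

/-- The homotopy relation on `Gal_k(K)`: there is a `K[t]`-Galois object over `k[t]` with
`[0]_*` and `[1]_*` equal to the given classes. -/
def Gal.Homotopic {k K : Type u} [CommRing k] [Ring K] [HopfAlgebra k K] (x y : Gal k K) : Prop :=
  ∃ (A : GaloisObject k[X] (k[X] ⊗[k] K)) (A₀ A₁ : GaloisObject k K),
    x = Gal.mk A₀ ∧ y = Gal.mk A₁ ∧
      (A.1.specialize 0).Isomorphic A₀.1 ∧ (A.1.specialize 1).Isomorphic A₁.1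

/-- The homotopy classes of left `K`-Galois objects: the quotient of `Gal_k(K)` by the
equivalence relation generated by `Gal.Homotopic`. -/
def HomotopyClasses (k K : Type u) [CommRing k] [Ring K] [HopfAlgebra k K] : Type (u + 1) :=
  Quot (Gal.Homotopic (k := k) (K := K))

/-- The homotopy class of an isomorphism class of Galois objects. -/
def Gal.homotopyClass {k K : Type u} [CommRing k] [Ring K] [HopfAlgebra k K] (x : Gal k K) :
    HomotopyClasses k K :=
  Quot.mk _ x

end

/-!
Let `Z` be an `H`-`K`-bi-Galois object. The proof has three ingredients: an intrinsic description
of cotensor products, a functor inverse to `Z □_K -`, and the compatibility of both with base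
change.

*Cotensor products by descent.* An `H`-comodule algebra `X` with a colinear algebra map
`i : X → Z ⊗ A` identifying it with the equalizer is called a cotensor product of `Z` and `A`
(`IsCotensor`). Bijectivity of the right canonical map of `Z` gives
`Z ⊗ (Z □_K A) = (Z ⊗ Z) □_K A ≅ (Z ⊗ K) □_K A = Z ⊗ A`, so the map `Z ⊗ X → Z ⊗ A`,
`z ⊗ x ↦ z i(x)`, is bijective (`bijective_extend`). By faithful flatness this bijectivity
conversely characterizes cotensor products (`isCotensor_of_bijective_extend`). Everything else is
read off from it after tensoring with `Z`: the map `X ⊗ A → Z ⊗ A` becomes the canonical map of `A`,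
and the canonical map of `Z`, transported along `X ⊗ A ≅ Z ⊗ A`, becomes that of `X`. Thus `X` is
Galois if and only if `A` is (`IsCotensor.isGaloisObject_iff`); for the direction from `X` to `A`,
the bijectivity of `X ⊗ A → Z ⊗ A` is the structure theorem for relative Hopf modules over `X`
(`bijective_mulTensor_coinvariantsOf`). That the coinvariants of a Galois object are trivial is
automatic by faithfully flat descent. Taking left `H`-coinvariants in `Z ⊗ X ≅ Z ⊗ A` recovers `A`,
so that `A` and `X` determine each other up to isomorphism (`IsCotensor.isomorphic_iff`).

*The inverse.* For an `H`-comodule algebra `B`, the coinvariants `S = (Zᵐᵒᵖ ⊗ B)^{co H}` of the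
diagonal coaction form an algebra, and the structure theorem for Hopf modules over `Z` gives
`Z ⊗ S ≅ Z ⊗ B` (`bijective_counitMap`). The preimage of `1 ⊗ b` defines an algebra map
`B → Z ⊗ S`, and the right `K`-coaction of `Z` descends along it to a left `K`-coaction of `S`. With
this structure `B` is the cotensor product of `Z` and `S` (`exists_isCotensor`), whether or
not `B` is Galois.

*Base change.* The base change of `Z` to `k[t]` is again bi-Galois
(`IsBiGaloisObject.baseChange`), and a cotensor product over `k[t]` specializes to one over `k`
(`IsCotensor.specialize`), since the characterization through `Z ⊗ X ≅ Z ⊗ A` is stable under base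
change. So a homotopy over `k[t]` between `K`-Galois objects is carried by the cotensor product with
the base change of `Z` to a homotopy between the corresponding `H`-Galois objects, and every
homotopy between the latter arises in this way. Hence the bijection on isomorphism classes respects
and reflects the homotopy relation, and descends to the quotients.
-/

noncomputable section

/-! ### Descent along faithfully flat modules, and the canonical map with coefficients -/

section Descent

variable {k : Type u} [CommRing k]

lemma Module.FaithfullyFlat.tensorProduct (V X : Type u) [AddCommGroup V] [Module k V]
    [AddCommGroup X] [Module k X] [Module.FaithfullyFlat k V] [Module.FaithfullyFlat k X] :
    Module.FaithfullyFlat k (V ⊗[k] X) := by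
  rw [Module.FaithfullyFlat.iff_flat_and_lTensor_reflects_triviality]
  refine ⟨inferInstance, fun N _ _ hN => ?_⟩
  have h1 : Subsingleton (V ⊗[k] (X ⊗[k] N)) := (TensorProduct.assoc k V X N).symm.subsingleton
  have h2 := Module.FaithfullyFlat.lTensor_reflects_triviality k V (X ⊗[k] N)
  exact Module.FaithfullyFlat.lTensor_reflects_triviality k X N

lemma Module.FaithfullyFlat.of_tensorProduct (V X : Type u) [AddCommGroup V] [Module k V]
    [AddCommGroup X] [Module k X] [Module.FaithfullyFlat k V]
    [Module.FaithfullyFlat k (V ⊗[k] X)] : Module.FaithfullyFlat k X := by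
  rw [Module.FaithfullyFlat.iff_flat_and_lTensor_reflects_triviality]
  constructor
  · rw [Module.Flat.iff_lTensor_preserves_injective_linearMap]
    intro N P _ _ _ _ f hf
    rw [← Module.FaithfullyFlat.lTensor_injective_iff_injective k V]
    have h1 := Module.Flat.lTensor_preserves_injective_linearMap (M := V ⊗[k] X) f hf
    rw [LinearMap.lTensor_tensor] at h1
    simpa using h1
  · intro N _ _ hN
    have h1 : Subsingleton (V ⊗[k] (X ⊗[k] N)) :=
      (Module.FaithfullyFlat.subsingleton_tensorProduct_iff_right k V).mpr hN
    have h2 : Subsingleton ((V ⊗[k] X) ⊗[k] N) := (TensorProduct.assoc k V X N).subsingleton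
    exact Module.FaithfullyFlat.lTensor_reflects_triviality k (V ⊗[k] X) N

/-- If tensoring the exact sequence `0 → E → M → N` with a flat module `V` gives, up to an
isomorphism on the middle term and an injection on the right term, the exact sequence
`0 → P → M' → N'`, then the comparison map `V ⊗ E → P` is bijective. -/
lemma LinearMap.bijective_of_flat_of_exact {V E M N P M' N' : Type u}
    [AddCommGroup V] [Module k V] [Module.Flat k V]
    [AddCommGroup E] [Module k E] [AddCommGroup M] [Module k M] [AddCommGroup N] [Module k N]
    [AddCommGroup P] [Module k P] [AddCommGroup M'] [Module k M'] [AddCommGroup N'] [Module k N']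
    {ι : E →ₗ[k] M} {D : M →ₗ[k] N} {e : P →ₗ[k] M'} {D' : M' →ₗ[k] N'}
    (hι : Function.Injective ι) (hD : Function.Exact ι D)
    (he : Function.Injective e) (hD' : Function.Exact e D')
    {m : V ⊗[k] E →ₗ[k] P} {cM : V ⊗[k] M →ₗ[k] M'} {cN : V ⊗[k] N →ₗ[k] N'}
    (hcM : Function.Bijective cM) (hcN : Function.Injective cN)
    (h₁ : ∀ x, e (m x) = cM (ι.lTensor V x)) (h₂ : ∀ x, cN (D.lTensor V x) = D' (cM x)) :
    Function.Bijective m := by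
  have hι' := Module.Flat.lTensor_preserves_injective_linearMap (M := V) ι hι
  have hD'' := Module.Flat.lTensor_exact V hD
  constructor
  · intro x y hxy
    exact hι' (hcM.1 (by rw [← h₁, ← h₁, hxy]))
  · intro p
    obtain ⟨w, hw⟩ := hcM.2 (e p)
    have h3 : D.lTensor V w = 0 := hcN (by rw [h₂, hw, map_zero]; exact (hD' _).mpr ⟨p, rfl⟩)
    obtain ⟨x, hx⟩ := (hD'' _).mp h3
    exact ⟨x, he (by rw [h₁, hx, hw])⟩

lemma Module.FaithfullyFlat.one_tmul_injective (V W : Type u) [Ring V] [Algebra k V]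
    [Module.FaithfullyFlat k V] [AddCommGroup W] [Module k W] :
    Function.Injective (TensorProduct.mk k V W 1) :=
  (injective_iff_map_eq_zero _).mpr fun w hw =>
    (Module.FaithfullyFlat.one_tmul_eq_zero_iff k W w).mp hw

/-- Descent of elements along a faithfully flat algebra `V`: an element `u` of `V ⊗ W` whose two
images in `V ⊗ V ⊗ W` agree comes from `W`. -/
lemma Module.FaithfullyFlat.exists_one_tmul_eq {V W : Type u} [Ring V] [Algebra k V]
    [Module.FaithfullyFlat k V] [AddCommGroup W] [Module k W] {u : V ⊗[k] W}
    (hu : (TensorProduct.mk k V W 1).lTensor V u = 1 ⊗ₜ u) : ∃ w, u = 1 ⊗ₜ w := by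
  let π := (LinearMap.range (TensorProduct.mk k V W 1)).mkQ
  have h1 : ∀ v, π.lTensor V ((TensorProduct.mk k V W 1).lTensor V v) = 0 := by
    intro v
    rw [← LinearMap.comp_apply, ← LinearMap.lTensor_comp, LinearMap.range_mkQ_comp]
    simp
  have h2 : (1 : V) ⊗ₜ[k] π u = 0 := (congrArg (π.lTensor V) hu).symm.trans (h1 u)
  rw [Module.FaithfullyFlat.one_tmul_eq_zero_iff, Submodule.mkQ_apply,
    Submodule.Quotient.mk_eq_zero] at h2
  obtain ⟨w, hw⟩ := h2
  exact ⟨w, hw.symm⟩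

lemma Algebra.TensorProduct.map_id_map_id {B C D E : Type u} [Ring B] [Algebra k B] [Ring C]
    [Algebra k C] [Ring D] [Algebra k D] [Ring E] [Algebra k E] (f : C →ₐ[k] D) (g : D →ₐ[k] E)
    (w : B ⊗[k] C) : Algebra.TensorProduct.map (AlgHom.id k B) g
      (Algebra.TensorProduct.map (AlgHom.id k B) f w) =
      Algebra.TensorProduct.map (AlgHom.id k B) (g.comp f) w := by
  induction w with
  | zero => simp
  | add x y hx hy => simp only [map_add, hx, hy]
  | tmul b c => simp

/-- The linear map `B ⊗ C → P`, `b ⊗ c ↦ f b * g c`. -/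
def LinearMap.mulTensor {B C P : Type u} [AddCommMonoid B] [Module k B] [AddCommMonoid C]
    [Module k C] [Ring P] [Algebra k P] (f : B →ₗ[k] P) (g : C →ₗ[k] P) : B ⊗[k] C →ₗ[k] P :=
  LinearMap.mul' k P ∘ₗ TensorProduct.map f g

@[simp]
lemma LinearMap.mulTensor_tmul {B C P : Type u} [AddCommMonoid B] [Module k B] [AddCommMonoid C]
    [Module k C] [Ring P] [Algebra k P] (f : B →ₗ[k] P) (g : C →ₗ[k] P) (b : B) (c : C) :
    LinearMap.mulTensor f g (b ⊗ₜ c) = f b * g c := rfl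

end Descent

section Coaction

variable {k H : Type u} [CommRing k] [Ring H] [Bialgebra k H] {P : Type u} [AddCommGroup P]
  [Module k P] (d : P →ₗ[k] H ⊗[k] P)

lemma injective_of_counit
    (hcounit : ∀ p, TensorProduct.lid k P
      ((Coalgebra.counit (R := k) (A := H)).rTensor P (d p)) = p) :
    Function.Injective d :=
  Function.LeftInverse.injective (g := fun w => TensorProduct.lid k P
      ((Coalgebra.counit (R := k) (A := H)).rTensor P w)) hcounit

/-- The (split) exact sequence `0 → P → H ⊗ P → H ⊗ H ⊗ P` of a comodule `P`. -/
lemma exact_of_coassoc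
    (hcoassoc : ∀ p, TensorProduct.assoc k H H P
      ((Coalgebra.comul (R := k) (A := H)).rTensor P (d p)) = d.lTensor H (d p)) :
    Function.Exact d (d.lTensor H - (TensorProduct.assoc k H H P).toLinearMap ∘ₗ
      (Coalgebra.comul (R := k) (A := H)).rTensor P) := by
  let Δ : H ⊗[k] P →ₗ[k] H ⊗[k] (H ⊗[k] P) := (TensorProduct.assoc k H H P).toLinearMap ∘ₗ
    (Coalgebra.comul (R := k) (A := H)).rTensor P
  have hεΔ : ∀ w, ((TensorProduct.lid k (H ⊗[k] P)).toLinearMap ∘ₗ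
      (Coalgebra.counit (R := k) (A := H)).rTensor (H ⊗[k] P)) (Δ w) = w := by
    intro w
    induction w with
    | zero => simp
    | add x y hx hy => rw [map_add, map_add, hx, hy]
    | tmul h p =>
      have h0 : ∀ t : H ⊗[k] H, TensorProduct.lid k (H ⊗[k] P)
          ((Coalgebra.counit (R := k) (A := H)).rTensor (H ⊗[k] P)
            (TensorProduct.assoc k H H P (t ⊗ₜ p))) =
          (TensorProduct.lid k H ((Coalgebra.counit (R := k) (A := H)).rTensor H t)) ⊗ₜ p := by
        intro t
        induction t with
        | zero => simp
        | add x y hx hy => simp only [map_add, TensorProduct.add_tmul, hx, hy]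
        | tmul x y => simp [TensorProduct.smul_tmul']
      refine (h0 _).trans ?_
      rw [Coalgebra.rTensor_counit_comul]
      simp
  have hεd : ∀ w, ((TensorProduct.lid k (H ⊗[k] P)).toLinearMap ∘ₗ
      (Coalgebra.counit (R := k) (A := H)).rTensor (H ⊗[k] P)) (d.lTensor H w) =
      d (TensorProduct.lid k P ((Coalgebra.counit (R := k) (A := H)).rTensor P w)) := by
    intro w
    induction w with
    | zero => simp
    | add x y hx hy => simp only [map_add, hx, hy]
    | tmul h p => simp
  intro w
  change (d.lTensor H - Δ) w = 0 ↔ _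
  rw [LinearMap.sub_apply, sub_eq_zero]
  constructor
  · intro hw
    exact ⟨_, by rw [← hεd, hw, hεΔ]⟩
  · rintro ⟨p, rfl⟩
    exact (hcoassoc p).symm

end Coaction

namespace LeftComoduleAlgebra

variable {k H : Type u} [CommRing k] [Ring H] [Bialgebra k H] (X : LeftComoduleAlgebra k H)

lemma can_tmul (x y : X) : X.can (x ⊗ₜ y) = X.coact x * (1 ⊗ₜ y) := rfl

section canAlong

variable {P : Type u} [Ring P] [Algebra k P] (j : X →ₐ[k] P)

/-- The algebra map `X → H ⊗ P` induced by the coaction of `X` and `j : X → P`. -/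
def coactAlong : X →ₐ[k] H ⊗[k] P := (Algebra.TensorProduct.map (AlgHom.id k H) j).comp X.coact

/-- The canonical map `X ⊗ P → H ⊗ P`, `x ⊗ p ↦ x₍₋₁₎ ⊗ j(x₍₀₎) p`, for an algebra `P` over `X`. -/
def canAlong : X ⊗[k] P →ₗ[k] H ⊗[k] P :=
  LinearMap.mulTensor (X.coactAlong j).toLinearMap
    (Algebra.TensorProduct.includeRight : P →ₐ[k] H ⊗[k] P).toLinearMap

lemma canAlong_tmul (x : X) (p : P) :
    X.canAlong j (x ⊗ₜ p) = X.coactAlong j x * (1 ⊗ₜ p) := rfl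

/-- The map `(X ⊗ X) ⊗ P → X ⊗ P`, `x ⊗ y ⊗ p ↦ x ⊗ j(y) p`. -/
def contractAlong : (X ⊗[k] X) ⊗[k] P →ₗ[k] X ⊗[k] P :=
  (LinearMap.mulTensor j.toLinearMap LinearMap.id).lTensor X ∘ₗ
    (TensorProduct.assoc k X X P).toLinearMap

lemma contractAlong_tmul (x y : X) (p : P) :
    X.contractAlong j ((x ⊗ₜ y) ⊗ₜ p) = x ⊗ₜ (j y * p) := rfl

lemma canAlong_contractAlong (t : X ⊗[k] X) (p : P) :
    X.canAlong j (X.contractAlong j (t ⊗ₜ p)) =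
      Algebra.TensorProduct.map (AlgHom.id k H) j (X.can t) * (1 ⊗ₜ p) := by
  induction t with
  | zero => simp
  | add s t hs ht => simp only [map_add, TensorProduct.add_tmul, hs, ht, add_mul]
  | tmul x y =>
    simp [contractAlong_tmul, canAlong_tmul, can_tmul, coactAlong, mul_assoc]

variable (hX : Function.Bijective X.can)
include hX

/-- If the canonical map of `X` is bijective, then so is that of any algebra `P` over `X`. The
inverse is `h ⊗ p ↦ h' ⊗ j(h'') p`, where `h' ⊗ h''` is the preimage of `h ⊗ 1` under the canonical
map of `X`. -/
lemma bijective_canAlong : Function.Bijective (X.canAlong j) := by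
  let e := LinearEquiv.ofBijective X.can hX
  have he : ∀ t, X.can (e.symm t) = t := fun t => e.apply_symm_apply t
  let τ : H →ₗ[k] X ⊗[k] X := e.symm.toLinearMap ∘ₗ (TensorProduct.mk k H X).flip 1
  let inv : H ⊗[k] P →ₗ[k] X ⊗[k] P := X.contractAlong j ∘ₗ τ.rTensor P
  have hτ : ∀ h, X.can (τ h) = h ⊗ₜ 1 := fun h => he _
  have h1 : ∀ w, X.canAlong j (inv w) = w := by
    intro w
    induction w with
    | zero => simp
    | add x y hx hy => simp only [map_add, hx, hy]
    | tmul h p =>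
      change X.canAlong j (X.contractAlong j (τ h ⊗ₜ p)) = _
      rw [canAlong_contractAlong, hτ]
      simp
  have hmul : ∀ (t : X ⊗[k] X) (y : X), X.can (t * (1 ⊗ₜ y)) = X.can t * (1 ⊗ₜ y) := by
    intro t y
    induction t with
    | zero => simp
    | add s t hs ht => simp only [map_add, hs, ht, add_mul]
    | tmul a b => simp [can_tmul, mul_assoc]
  have h2 : ∀ w : H ⊗[k] X, ∀ p, inv (Algebra.TensorProduct.map (AlgHom.id k H) j w * (1 ⊗ₜ p)) =
      X.contractAlong j (e.symm w ⊗ₜ p) := by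
    intro w p
    induction w with
    | zero => simp
    | add x y hx hy => simp only [map_add, add_mul, TensorProduct.add_tmul, hx, hy]
    | tmul h x =>
      have h3 : e.symm (h ⊗ₜ x) = τ h * (1 ⊗ₜ x) := hX.1 (by rw [he, hmul, hτ]; simp)
      rw [h3]
      simp only [Algebra.TensorProduct.map_tmul, Algebra.TensorProduct.tmul_mul_tmul, mul_one,
        AlgHom.id_apply]
      change X.contractAlong j (τ h ⊗ₜ _) = _
      induction τ h with
      | zero => simp
      | add s t hs ht => simp only [map_add, TensorProduct.add_tmul, hs, ht, add_mul]
      | tmul a b => simp [contractAlong_tmul, mul_assoc]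
  refine ⟨Function.LeftInverse.injective (g := inv) fun w => ?_, fun w => ⟨inv w, h1 w⟩⟩
  induction w with
  | zero => simp
  | add x y hx hy => simp only [map_add, hx, hy]
  | tmul x p =>
    rw [canAlong_tmul, coactAlong, AlgHom.comp_apply, h2]
    have h3 : e.symm (X.coact x) = x ⊗ₜ 1 := hX.1 (by
      rw [he, can_tmul, ← Algebra.TensorProduct.one_def, mul_one])
    rw [h3]
    simp [contractAlong_tmul]

end canAlong

section HopfModule

variable {P : Type u} [Ring P] [Algebra k P] (d : P →ₗ[k] H ⊗[k] P)

/-- The elements `p` with `d p = 1 ⊗ p`. -/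
def coinvariantsOf : Submodule k P :=
  LinearMap.ker (d - (Algebra.TensorProduct.includeRight : P →ₐ[k] H ⊗[k] P).toLinearMap)

lemma mem_coinvariantsOf {p : P} : p ∈ coinvariantsOf d ↔ d p = 1 ⊗ₜ p := by
  simp [coinvariantsOf, sub_eq_zero]

/-- The structure theorem for relative Hopf modules: if `P` is an algebra over `X`, with an
`H`-coaction `d` making it a Hopf module under left multiplication by `X`, then `P` is generated
freely over `X` by its coinvariants, i.e. `X ⊗ P^{co H} → P` is bijective. -/
lemma bijective_mulTensor_coinvariantsOf [Module.Flat k X] (hX : Function.Bijective X.can)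
    (j : X →ₐ[k] P)
    (hcoassoc : ∀ p, TensorProduct.assoc k H H P
      ((Coalgebra.comul (R := k) (A := H)).rTensor P (d p)) = d.lTensor H (d p))
    (hcounit : ∀ p, TensorProduct.lid k P
      ((Coalgebra.counit (R := k) (A := H)).rTensor P (d p)) = p)
    (hd : ∀ x p, d (j x * p) = X.coactAlong j x * d p) :
    Function.Bijective (LinearMap.mulTensor j.toLinearMap (coinvariantsOf d).subtype) := by
  let Δ : H ⊗[k] P →ₗ[k] H ⊗[k] (H ⊗[k] P) := (TensorProduct.assoc k H H P).toLinearMap ∘ₗ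
    (Coalgebra.comul (R := k) (A := H)).rTensor P
  let inr : P →ₗ[k] H ⊗[k] P :=
    (Algebra.TensorProduct.includeRight : P →ₐ[k] H ⊗[k] P).toLinearMap
  have hdinj := injective_of_counit d hcounit
  have hex := exact_of_coassoc d hcoassoc
  have hjN : ∀ x p, X.coactAlong (X.coactAlong j) x * (1 ⊗ₜ (1 ⊗ₜ p)) =
      Δ (X.coactAlong j x * (1 ⊗ₜ p)) := by
    intro x p
    have h1 : X.coactAlong (X.coactAlong j) x =
        Algebra.TensorProduct.map (AlgHom.id k H) (Algebra.TensorProduct.map (AlgHom.id k H) j)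
          (Algebra.TensorProduct.map (AlgHom.id k H) X.coact (X.coact x)) := by
      rw [Algebra.TensorProduct.map_id_map_id]
      rfl
    rw [h1, ← X.coassoc, coactAlong, AlgHom.comp_apply]
    induction X.coact x with
    | zero => simp
    | add x y hx hy => simp only [map_add, add_mul, hx, hy]
    | tmul h y =>
      simp only [Algebra.TensorProduct.map_tmul, AlgHom.id_apply, Bialgebra.comulAlgHom_apply,
        Algebra.TensorProduct.tmul_mul_tmul, mul_one, Δ, LinearMap.comp_apply,
        LinearMap.rTensor_tmul, LinearEquiv.coe_coe]
      induction Coalgebra.comul (R := k) h with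
      | zero => simp
      | add x y hx hy => simp only [map_add, add_mul, TensorProduct.add_tmul, hx, hy]
      | tmul a b => simp
  have hjd : ∀ (w : H ⊗[k] X) p, Algebra.TensorProduct.map (AlgHom.id k H) (X.coactAlong j) w *
      (1 ⊗ₜ d p) = d.lTensor H (Algebra.TensorProduct.map (AlgHom.id k H) j w * (1 ⊗ₜ p)) := by
    intro w p
    induction w with
    | zero => simp
    | add x y hx hy => simp only [map_add, add_mul, hx, hy]
    | tmul h y => simp [hd]
  refine LinearMap.bijective_of_flat_of_exact (ι := (coinvariantsOf d).subtype)
    (D := d - inr) (e := d) (D' := d.lTensor H - Δ) (cM := X.canAlong j)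
    (cN := X.canAlong (X.coactAlong j)) (Submodule.subtype_injective _)
    (LinearMap.exact_subtype_ker_map _) hdinj hex (X.bijective_canAlong j hX)
    (X.bijective_canAlong _ hX).1 ?_ ?_
  · intro w
    induction w with
    | zero => simp
    | add x y hx hy => simp only [map_add, hx, hy]
    | tmul x p =>
      have hp := (mem_coinvariantsOf d).mp p.2
      simp only [LinearMap.mulTensor_tmul, AlgHom.toLinearMap_apply, Submodule.subtype_apply, hd,
        LinearMap.lTensor_tmul, canAlong_tmul, hp]
  · intro w
    induction w with
    | zero => simp
    | add x y hx hy => simp only [map_add, hx, hy]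
    | tmul x p =>
      simp only [LinearMap.lTensor_tmul, LinearMap.sub_apply, TensorProduct.tmul_sub, map_sub,
        canAlong_tmul]
      congr 1
      · exact hjd _ _
      · exact hjN _ _

end HopfModule

end LeftComoduleAlgebra

/-! ### Cotensor products as solutions of a descent problem -/

namespace LeftComoduleAlgebra

variable {k H : Type u} [CommRing k] [Ring H] [Bialgebra k H] (X : LeftComoduleAlgebra k H)

section coactLeft

variable (W : Type u) [Ring W] [Algebra k W]

/-- The coaction `δ ⊗ id : X ⊗ W → H ⊗ (X ⊗ W)`. -/
def coactLeft : X ⊗[k] W →ₐ[k] H ⊗[k] (X ⊗[k] W) :=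
  (Algebra.TensorProduct.assoc k k k H X W).toAlgHom.comp
    (Algebra.TensorProduct.map X.coact (AlgHom.id k W))

lemma coactLeft_tmul (x : X) (w : W) : X.coactLeft W (x ⊗ₜ w) =
    X.coactAlong Algebra.TensorProduct.includeLeft x * (1 ⊗ₜ (1 ⊗ₜ w)) := by
  simp only [coactLeft, coactAlong, AlgHom.comp_apply, Algebra.TensorProduct.map_tmul,
    AlgHom.id_apply]
  induction X.coact x with
  | zero => simp
  | add x y hx hy => simp only [map_add, TensorProduct.add_tmul, add_mul, hx, hy]
  | tmul h y => simp

variable {W} in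
lemma coactLeft_map {W' : Type u} [Ring W'] [Algebra k W'] (f : W →ₐ[k] W') (v : X ⊗[k] W) :
    X.coactLeft W' (Algebra.TensorProduct.map (AlgHom.id k X) f v) =
      Algebra.TensorProduct.map (AlgHom.id k H)
        (Algebra.TensorProduct.map (AlgHom.id k X) f) (X.coactLeft W v) := by
  induction v with
  | zero => simp
  | add x y hx hy => simp only [map_add, hx, hy]
  | tmul z a =>
    simp only [coactLeft, AlgHom.comp_apply, Algebra.TensorProduct.map_tmul, AlgHom.id_apply]
    induction X.coact z with
    | zero => simp
    | add x y hx hy => simp only [map_add, TensorProduct.add_tmul, hx, hy]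
    | tmul z c => simp

variable {W} in
/-- The coinvariants of `X ⊗ W` under `δ ⊗ id` are `1 ⊗ W`. -/
lemma exists_one_tmul_eq_of_coactLeft [Module.FaithfullyFlat k X]
    (hX : Function.Bijective X.can) {u : X ⊗[k] W} (hu : X.coactLeft W u = 1 ⊗ₜ u) :
    ∃ w, u = 1 ⊗ₜ w := by
  refine Module.FaithfullyFlat.exists_one_tmul_eq
    ((X.bijective_canAlong Algebra.TensorProduct.includeLeft hX).1 ?_)
  have h1 : ∀ v : X ⊗[k] W, X.canAlong Algebra.TensorProduct.includeLeft
      ((TensorProduct.mk k X W 1).lTensor X v) = X.coactLeft W v := by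
    intro v
    induction v with
    | zero => simp
    | add x y hx hy => simp only [map_add, hx, hy]
    | tmul x w => rw [coactLeft_tmul]; rfl
  rw [h1, hu, canAlong_tmul, map_one, one_mul]

end coactLeft

/-- An algebra which is faithfully flat and has a bijective canonical map is a Galois object: the
coinvariants are automatically trivial. -/
lemma isGaloisObject_iff :
    X.IsGaloisObject ↔ Function.Bijective X.can ∧ Module.FaithfullyFlat k X := by
  refine ⟨fun h => ⟨h.2, h.3⟩, fun ⟨h1, h2⟩ => ⟨eq_bot_iff.mpr fun a ha => ?_, h1, h2⟩⟩
  have ha' : X.coact a = 1 ⊗ₜ a := ha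
  have h3 : a ⊗ₜ[k] (1 : X) = 1 ⊗ₜ a := h1.1 (by
    rw [can_tmul, can_tmul, ha', map_one, one_mul, ← Algebra.TensorProduct.one_def, mul_one])
  have h4 : ∃ c : k, (TensorProduct.rid k X).symm a = 1 ⊗ₜ c := by
    refine Module.FaithfullyFlat.exists_one_tmul_eq
      (((TensorProduct.rid k X).lTensor X).injective ?_)
    simpa using h3
  obtain ⟨c, hc⟩ := h4
  rw [LinearEquiv.symm_apply_eq] at hc
  exact ⟨c, by rw [hc]; simp [Algebra.algebraMap_eq_smul_one]⟩

end LeftComoduleAlgebra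

namespace BicomoduleAlgebra

variable {k H K : Type u} [CommRing k] [Ring H] [Bialgebra k H] [Ring K] [Bialgebra k K]
  (Z : BicomoduleAlgebra k H K)

lemma coactId_eq_coactLeft (A : LeftComoduleAlgebra k K) : Z.coactId A = Z.coactLeft A := rfl

section rcoactRight

variable (W : Type u) [Ring W] [Algebra k W]

/-- The map `ρ ⊗ id : Z ⊗ W → Z ⊗ (K ⊗ W)`. -/
def rcoactRight : Z.carrier ⊗[k] W →ₐ[k] Z.carrier ⊗[k] (K ⊗[k] W) :=
  (Algebra.TensorProduct.assoc k k k Z.carrier K W).toAlgHom.comp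
    (Algebra.TensorProduct.map Z.rcoact (AlgHom.id k W))

/-- The right canonical map with coefficients, `Z ⊗ (Z ⊗ W) → Z ⊗ (K ⊗ W)`,
`z ⊗ (y ⊗ w) ↦ z y₍₀₎ ⊗ y₍₁₎ ⊗ w`. -/
def rcanRight : Z.carrier ⊗[k] (Z.carrier ⊗[k] W) →ₗ[k] Z.carrier ⊗[k] (K ⊗[k] W) :=
  LinearMap.mulTensor (Algebra.TensorProduct.includeLeft :
    Z.carrier →ₐ[k] Z.carrier ⊗[k] (K ⊗[k] W)).toLinearMap (Z.rcoactRight W).toLinearMap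

lemma rcanRight_tmul (z : Z.carrier) (u : Z.carrier ⊗[k] W) :
    Z.rcanRight W (z ⊗ₜ u) = (z ⊗ₜ 1) * Z.rcoactRight W u := rfl

lemma bijective_rcanRight (hZ : Function.Bijective Z.rcan) :
    Function.Bijective (Z.rcanRight W) := by
  let e : Z.carrier ⊗[k] (Z.carrier ⊗[k] W) ≃ₗ[k] Z.carrier ⊗[k] (K ⊗[k] W) :=
    (TensorProduct.assoc k Z.carrier Z.carrier W).symm ≪≫ₗ
      (LinearEquiv.ofBijective Z.rcan hZ).rTensor W ≪≫ₗ TensorProduct.assoc k Z.carrier K W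
  have he : Z.rcanRight W = e.toLinearMap := by
    ext z y w
    change (z ⊗ₜ 1) * Algebra.TensorProduct.assoc k k k Z.carrier K W (Z.rcoact y ⊗ₜ w) =
      Algebra.TensorProduct.assoc k k k Z.carrier K W (((z ⊗ₜ 1) * Z.rcoact y) ⊗ₜ w)
    induction Z.rcoact y with
    | zero => simp
    | add x y hx hy => simp only [map_add, TensorProduct.add_tmul, mul_add, hx, hy]
    | tmul y c => simp
  rw [he]
  exact e.bijective

end rcoactRight

variable (A : LeftComoduleAlgebra k K)

section Cotensor

variable {X : Type u} [AddCommGroup X] [Module k X] (i : X →ₗ[k] Z.carrier ⊗[k] A)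

/-- The map `Z ⊗ X → Z ⊗ A`, `z ⊗ x ↦ (z ⊗ 1) i(x)`, for a map `i : X → Z ⊗ A`. -/
def extend : Z.carrier ⊗[k] X →ₗ[k] Z.carrier ⊗[k] A :=
  LinearMap.mulTensor (Algebra.TensorProduct.includeLeft :
    Z.carrier →ₐ[k] Z.carrier ⊗[k] A).toLinearMap i

lemma extend_tmul (z : Z.carrier) (x : X) : Z.extend A i (z ⊗ₜ x) = (z ⊗ₜ 1) * i x := rfl

lemma idCoact_tmul_one (z : Z.carrier) : Z.idCoact A (z ⊗ₜ 1) = z ⊗ₜ 1 := by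
  simp [idCoact]

lemma rcoactRight_idCoact (y : Z.carrier ⊗[k] A) : Z.rcoactRight (K ⊗[k] A) (Z.idCoact A y) =
    Algebra.TensorProduct.map (AlgHom.id k Z.carrier)
      (Algebra.TensorProduct.map (AlgHom.id k K) A.coact) (Z.rcoactId A y) := by
  induction y with
  | zero => simp
  | add x y hx hy => simp only [map_add, hx, hy]
  | tmul z a =>
    simp only [idCoact, rcoactId, rcoactRight, AlgHom.comp_apply, Algebra.TensorProduct.map_tmul,
      AlgHom.id_apply]
    induction Z.rcoact z with
    | zero => simp
    | add x y hx hy => simp only [map_add, TensorProduct.add_tmul, hx, hy]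
    | tmul z c => simp

lemma rcoactRight_rcoactRight (W : Type u) [Ring W] [Algebra k W] (y : Z.carrier ⊗[k] W) :
    Z.rcoactRight (K ⊗[k] W) (Z.rcoactRight W y) =
    Algebra.TensorProduct.map (AlgHom.id k Z.carrier)
      ((Algebra.TensorProduct.assoc k k k K K W).toAlgHom.comp
        (Algebra.TensorProduct.map (Bialgebra.comulAlgHom k K) (AlgHom.id k W)))
      (Z.rcoactRight W y) := by
  induction y with
  | zero => simp
  | add x y hx hy => simp only [map_add, hx, hy]
  | tmul z a =>
    let N : Z.carrier ⊗[k] (K ⊗[k] K) →ₗ[k] Z.carrier ⊗[k] (K ⊗[k] (K ⊗[k] W)) :=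
      LinearMap.lTensor Z.carrier ((TensorProduct.assoc k K K W).toLinearMap ∘ₗ
        (TensorProduct.mk k (K ⊗[k] K) W).flip a)
    have key1 : ∀ w : Z.carrier ⊗[k] K, Z.rcoactRight (K ⊗[k] W)
        (Algebra.TensorProduct.assoc k k k Z.carrier K W (w ⊗ₜ a)) =
        N (Algebra.TensorProduct.assoc k k k Z.carrier K K
          (Algebra.TensorProduct.map Z.rcoact (AlgHom.id k K) w)) := by
      intro w
      induction w with
      | zero => simp only [map_zero, TensorProduct.zero_tmul]
      | add x y hx hy => simp only [map_add, TensorProduct.add_tmul, hx, hy]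
      | tmul z' x =>
        simp only [rcoactRight, AlgHom.comp_apply, Algebra.TensorProduct.assoc_tmul,
          AlgEquiv.toAlgHom_apply, Algebra.TensorProduct.map_tmul, AlgHom.id_apply]
        induction Z.rcoact z' with
        | zero => simp only [map_zero, TensorProduct.zero_tmul]
        | add x y hx hy => simp only [map_add, TensorProduct.add_tmul, hx, hy]
        | tmul h z'' => simp [N]
    have key2 : ∀ w : Z.carrier ⊗[k] K,
        Algebra.TensorProduct.map (AlgHom.id k Z.carrier)
          ((Algebra.TensorProduct.assoc k k k K K W).toAlgHom.comp
            (Algebra.TensorProduct.map (Bialgebra.comulAlgHom k K) (AlgHom.id k W)))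
          (Algebra.TensorProduct.assoc k k k Z.carrier K W (w ⊗ₜ a)) =
        N (Algebra.TensorProduct.map (AlgHom.id k Z.carrier) (Bialgebra.comulAlgHom k K) w) := by
      intro w
      induction w with
      | zero => simp only [map_zero, TensorProduct.zero_tmul]
      | add x y hx hy => simp only [map_add, TensorProduct.add_tmul, hx, hy]
      | tmul h z' => simp [N]; rfl
    exact (key1 (Z.rcoact z)).trans ((congrArg N (Z.rcoassoc z)).trans
      (key2 (Z.rcoact z)).symm)

lemma injective_idCoact : Function.Injective (Z.idCoact A) := by
  refine Function.LeftInverse.injective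
    (g := (TensorProduct.lid k A).toLinearMap.lTensor Z.carrier ∘ₗ
      ((Coalgebra.counit (R := k) (A := K)).rTensor A).lTensor Z.carrier) fun y => ?_
  induction y with
  | zero => simp
  | add x y hx hy => simp only [map_add, hx, hy]
  | tmul z a => exact congrArg (z ⊗ₜ[k] ·) (A.counit a)

/-- If `i` identifies `X` with the cotensor product `Z □ A`, then `Z ⊗ X → Z ⊗ A` is bijective:
the right canonical map identifies `Z ⊗ (Z □ A) = (Z ⊗ Z) □ A` with `(Z ⊗ K) □ A = Z ⊗ A`. -/
lemma bijective_extend [Module.Flat k Z.carrier] (hZ : Function.Bijective Z.rcan)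
    (hi : Function.Injective i)
    (hrange : ∀ y, y ∈ Set.range i ↔ Z.rcoactId A y = Z.idCoact A y) :
    Function.Bijective (Z.extend A i) := by
  have hexA := exact_of_coassoc A.coact.toLinearMap A.coassoc
  have hex := Module.Flat.lTensor_exact Z.carrier hexA
  refine LinearMap.bijective_of_flat_of_exact (ι := i)
    (D := (Z.rcoactId A).toLinearMap - (Z.idCoact A).toLinearMap)
    (e := (Z.idCoact A).toLinearMap)
    (cM := Z.rcanRight A) (cN := -Z.rcanRight (K ⊗[k] A)) hi
    (fun y => by simp [sub_eq_zero, hrange y]) (Z.injective_idCoact A) hex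
    (Z.bijective_rcanRight A hZ)
    (neg_injective.comp (Z.bijective_rcanRight _ hZ).1) ?_ ?_
  · intro w
    induction w with
    | zero => simp
    | add x y hx hy => simp only [map_add, hx, hy]
    | tmul z x =>
      have h1 := (hrange (i x)).mp ⟨x, rfl⟩
      rw [extend_tmul, AlgHom.toLinearMap_apply, map_mul, idCoact_tmul_one, ← h1]
      rfl
  · intro w
    induction w with
    | zero => simp
    | add x y hx hy => simp only [map_add, hx, hy]
    | tmul z y =>
      have h1 : ∀ f : (K ⊗[k] A) →ₐ[k] K ⊗[k] (K ⊗[k] A), ∀ v,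
          (z ⊗ₜ[k] (1 : K ⊗[k] (K ⊗[k] A))) * Algebra.TensorProduct.map (AlgHom.id k Z.carrier) f v
            = f.toLinearMap.lTensor Z.carrier ((z ⊗ₜ 1) * v) := by
        intro f v
        change _ = Algebra.TensorProduct.map (AlgHom.id k Z.carrier) f _
        rw [map_mul]
        simp
      rw [LinearMap.lTensor_tmul, LinearMap.sub_apply, TensorProduct.tmul_sub, map_sub,
        LinearMap.lTensor_sub, LinearMap.sub_apply, LinearMap.neg_apply, LinearMap.neg_apply,
        rcanRight_tmul, rcanRight_tmul, rcanRight_tmul]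
      simp only [AlgHom.toLinearMap_apply]
      rw [rcoactRight_idCoact, h1]
      rw [show Z.rcoactRight (K ⊗[k] A) (Z.rcoactId A y) = _ from
        Z.rcoactRight_rcoactRight A y, h1, neg_sub_neg]
      rfl

end Cotensor

/-- An `H`-comodule algebra `X` with an algebra map `i : X → Z ⊗ A` is a cotensor product of `Z`
and `A` if `i` is an `H`-colinear isomorphism onto the equalizer of the two coactions. -/
structure IsCotensor (X : LeftComoduleAlgebra k H) (i : X →ₐ[k] Z.carrier ⊗[k] A) : Prop where
  injective : Function.Injective i
  mem_range_iff : ∀ y, y ∈ Set.range i ↔ Z.rcoactId A y = Z.idCoact A y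
  coact : ∀ x, Z.coactId A (i x) = Algebra.TensorProduct.map (AlgHom.id k H) i (X.coact x)

lemma isCotensor_cotensor (hH : Module.Flat k H) :
    Z.IsCotensor A (Z.cotensor A hH) (Z.cotensorSubalgebra A).val where
  injective := Subtype.val_injective
  mem_range_iff y := ⟨fun ⟨x, hx⟩ => hx ▸ x.2, fun hy => ⟨⟨y, hy⟩, rfl⟩⟩
  coact x := (Z.cotensorIncl_cotensorCoact A hH x).symm

variable {Z A} {X : LeftComoduleAlgebra k H} {i : X →ₐ[k] Z.carrier ⊗[k] A}

lemma IsCotensor.bijective_extend [Module.Flat k Z.carrier] (hZ : Function.Bijective Z.rcan)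
    (h : Z.IsCotensor A X i) : Function.Bijective (Z.extend A i.toLinearMap) :=
  Z.bijective_extend A _ hZ h.injective h.mem_range_iff

/-- A colinear algebra map into the equalizer whose extension `Z ⊗ X → Z ⊗ A` is bijective
identifies `X` with the cotensor product. -/
lemma isCotensor_of_bijective_extend [Module.FaithfullyFlat k Z.carrier]
    (hZ : Function.Bijective Z.rcan) (heq : ∀ x, Z.rcoactId A (i x) = Z.idCoact A (i x))
    (hcoact : ∀ x, Z.coactId A (i x) = Algebra.TensorProduct.map (AlgHom.id k H) i (X.coact x))
    (hbij : Function.Bijective (Z.extend A i.toLinearMap)) : Z.IsCotensor A X i := by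
  let ι := (Z.cotensorSubalgebra A).val
  let i' : X →ₐ[k] Z.cotensorSubalgebra A := i.codRestrict _ heq
  have h1 := Z.bijective_extend A ι.toLinearMap hZ Subtype.val_injective
    fun y => ⟨fun ⟨x, hx⟩ => hx ▸ x.2, fun hy => ⟨⟨y, hy⟩, rfl⟩⟩
  have h2 : Z.extend A i.toLinearMap =
      Z.extend A ι.toLinearMap ∘ₗ i'.toLinearMap.lTensor Z.carrier := by
    ext; rfl
  rw [h2, LinearMap.coe_comp, h1.of_comp_iff',
    Module.FaithfullyFlat.lTensor_bijective_iff_bijective] at hbij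
  refine ⟨Subtype.val_injective.comp hbij.1, fun y => ⟨?_, fun hy => ?_⟩, hcoact⟩
  · rintro ⟨x, rfl⟩
    exact heq x
  · obtain ⟨x, hx⟩ := hbij.2 ⟨y, hy⟩
    exact ⟨x, congrArg Subtype.val hx⟩

end BicomoduleAlgebra

/-! ### Cotensor products of Galois objects -/

namespace BicomoduleAlgebra

variable {k H K : Type u} [CommRing k] [Ring H] [Bialgebra k H] [Ring K] [Bialgebra k K]
  {Z : BicomoduleAlgebra k H K} {A : LeftComoduleAlgebra k K}
  {X : LeftComoduleAlgebra k H} {i : X →ₐ[k] Z.carrier ⊗[k] A}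

section Galois

variable (A i) in
/-- The map `X ⊗ A → Z ⊗ A`, `x ⊗ a ↦ i(x) (1 ⊗ a)`. -/
def rightExtend : X ⊗[k] A →ₗ[k] Z.carrier ⊗[k] A :=
  LinearMap.mulTensor i.toLinearMap
    (Algebra.TensorProduct.includeRight : A →ₐ[k] Z.carrier ⊗[k] A).toLinearMap

lemma rightExtend_tmul (x : X) (a : A) : rightExtend A i (x ⊗ₜ a) = i x * (1 ⊗ₜ a) := rfl

lemma lTensor_can_assoc (v : Z.carrier ⊗[k] A) (a : A) :
    A.can.lTensor Z.carrier (TensorProduct.assoc k Z.carrier A A (v ⊗ₜ a)) =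
      Z.idCoact A v * (1 ⊗ₜ (1 ⊗ₜ a)) := by
  induction v with
  | zero => simp
  | add x y hx hy => simp only [map_add, TensorProduct.add_tmul, add_mul, hx, hy]
  | tmul z b => simp [LeftComoduleAlgebra.can_tmul, idCoact]

/-- After tensoring with `Z`, the map `X ⊗ A → Z ⊗ A` becomes the canonical map of `A`. -/
lemma IsCotensor.bijective_rightExtend_iff [Module.FaithfullyFlat k Z.carrier]
    (hZ : Function.Bijective Z.rcan) (h : Z.IsCotensor A X i) :
    Function.Bijective (rightExtend A i) ↔ Function.Bijective A.can := by
  let μ := LinearEquiv.ofBijective _ (h.bijective_extend hZ)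
  let e : Z.carrier ⊗[k] (X ⊗[k] A) ≃ₗ[k] Z.carrier ⊗[k] (A ⊗[k] A) :=
    (TensorProduct.assoc k Z.carrier X A).symm ≪≫ₗ μ.rTensor A ≪≫ₗ
      TensorProduct.assoc k Z.carrier A A
  have key : Z.rcanRight A ∘ₗ (rightExtend A i).lTensor Z.carrier =
      A.can.lTensor Z.carrier ∘ₗ e.toLinearMap := by
    ext z x a
    have h1 : Z.rcoactRight A (i x) = Z.idCoact A (i x) := (h.mem_range_iff _).mp ⟨x, rfl⟩
    change (z ⊗ₜ 1) * Z.rcoactRight A (i x * (1 ⊗ₜ a)) =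
      A.can.lTensor Z.carrier (TensorProduct.assoc k Z.carrier A A (((z ⊗ₜ 1) * i x) ⊗ₜ a))
    rw [lTensor_can_assoc, map_mul, map_mul, idCoact_tmul_one, h1, mul_assoc]
    congr 2
    simp [rcoactRight, Algebra.TensorProduct.one_def]
  rw [← Module.FaithfullyFlat.lTensor_bijective_iff_bijective k Z.carrier A.can,
    ← Module.FaithfullyFlat.lTensor_bijective_iff_bijective k Z.carrier (rightExtend A i),
    ← (Z.bijective_rcanRight A hZ).of_comp_iff', ← LinearMap.coe_comp, key, LinearMap.coe_comp]
  exact Function.Bijective.of_comp_iff _ e.bijective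

lemma IsCotensor.coactAlong_eq (h : Z.IsCotensor A X i) (x : X) :
    X.coactAlong i x = Z.coactLeft A (i x) := (h.coact x).symm

/-- The structure theorem for Hopf modules over the Galois object `X`, applied to `Z ⊗ A`, whose
coinvariants are `1 ⊗ A`. -/
lemma IsCotensor.bijective_rightExtend (hZ : Z.toLeftComoduleAlgebra.IsGaloisObject)
    (hX : X.IsGaloisObject) (h : Z.IsCotensor A X i) : Function.Bijective (rightExtend A i) := by
  have := hZ.faithfullyFlat
  have := hX.faithfullyFlat
  let d := (Z.coactLeft A).toLinearMap
  have hS := LeftComoduleAlgebra.bijective_mulTensor_coinvariantsOf X d hX.bijective_can i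
    (Z.coactId_coassoc A) (fun y => by
      induction y with
      | zero => simp
      | add x y hx hy => simp only [map_add, hx, hy]
      | tmul z a =>
        have h1 : ∀ w : H ⊗[k] Z.carrier, TensorProduct.lid k (Z.carrier ⊗[k] A)
            ((Coalgebra.counit (R := k) (A := H)).rTensor (Z.carrier ⊗[k] A)
              (TensorProduct.assoc k H Z.carrier A (w ⊗ₜ a))) =
            TensorProduct.lid k Z.carrier
              ((Coalgebra.counit (R := k) (A := H)).rTensor Z.carrier w) ⊗ₜ a := by
          intro w
          induction w with
          | zero => simp
          | add x y hx hy => simp only [map_add, TensorProduct.add_tmul, hx, hy]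
          | tmul h z' => simp [TensorProduct.smul_tmul']
        exact (h1 (Z.coact z)).trans (congrArg (· ⊗ₜ[k] a) (Z.counit z)))
    (fun x y => by rw [h.coactAlong_eq]; exact map_mul (Z.coactLeft A) _ _)
  have hmem : ∀ a : A, (TensorProduct.mk k Z.carrier A 1) a ∈
      LeftComoduleAlgebra.coinvariantsOf d := fun a => by
    rw [LeftComoduleAlgebra.mem_coinvariantsOf]
    simp [d, LeftComoduleAlgebra.coactLeft_tmul]
  let f : A →ₗ[k] LeftComoduleAlgebra.coinvariantsOf d :=
    (TensorProduct.mk k Z.carrier A 1).codRestrict _ hmem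
  have hf : Function.Bijective f := by
    constructor
    · intro a b hab
      exact Module.FaithfullyFlat.one_tmul_injective Z.carrier A (congrArg Subtype.val hab)
    · intro p
      obtain ⟨a, ha⟩ := Z.exists_one_tmul_eq_of_coactLeft hZ.bijective_can
        ((LeftComoduleAlgebra.mem_coinvariantsOf d).mp p.2)
      exact ⟨a, Subtype.ext ha.symm⟩
  have h2 : rightExtend A i = LinearMap.mulTensor i.toLinearMap
      (LeftComoduleAlgebra.coinvariantsOf d).subtype ∘ₗ f.lTensor X := by
    ext; rfl
  rw [h2, LinearMap.coe_comp]
  exact hS.comp ((LinearEquiv.ofBijective f hf).lTensor X).bijective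

/-- The canonical map of `X` is obtained from that of `Z` by the isomorphism `X ⊗ A → Z ⊗ A`. -/
lemma IsCotensor.bijective_can (hZ : Function.Bijective Z.can) [Module.FaithfullyFlat k A]
    (h : Z.IsCotensor A X i) (hθ : Function.Bijective (rightExtend A i)) :
    Function.Bijective X.can := by
  let θ := LinearEquiv.ofBijective _ hθ
  -- `x ⊗ (z ⊗ a) ↦ y ⊗ (z ⊗ b a)` where `i x = y ⊗ b`
  let T : X ⊗[k] (Z.carrier ⊗[k] A) ≃ₗ[k] Z.carrier ⊗[k] (Z.carrier ⊗[k] A) :=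
    TensorProduct.leftComm k X Z.carrier A ≪≫ₗ θ.lTensor Z.carrier ≪≫ₗ
      TensorProduct.leftComm k Z.carrier Z.carrier A
  have hT : X.canAlong i =
      Z.canAlong (Algebra.TensorProduct.includeLeft : Z.carrier →ₐ[k] Z.carrier ⊗[k] A) ∘ₗ
        T.toLinearMap := by
    ext x z a
    change X.coactAlong i x * (1 ⊗ₜ (z ⊗ₜ a)) = Z.canAlong _
      (TensorProduct.leftComm k Z.carrier Z.carrier A (z ⊗ₜ (i x * (1 ⊗ₜ a))))
    rw [h.coactAlong_eq]
    induction i x with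
    | zero => simp
    | add x y hx hy => simp only [map_add, TensorProduct.tmul_add, add_mul, hx, hy]
    | tmul y b =>
      simp [LeftComoduleAlgebra.coactLeft_tmul, LeftComoduleAlgebra.canAlong_tmul, mul_assoc]
  have hc : Function.Bijective (X.canAlong i) := by
    rw [hT, LinearMap.coe_comp]
    exact (Z.bijective_canAlong _ hZ).comp T.bijective
  let e : X ⊗[k] (X ⊗[k] A) ≃ₗ[k] (X ⊗[k] X) ⊗[k] A := (TensorProduct.assoc k X X A).symm
  let e' : (H ⊗[k] X) ⊗[k] A ≃ₗ[k] H ⊗[k] (Z.carrier ⊗[k] A) :=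
    TensorProduct.assoc k H X A ≪≫ₗ θ.lTensor H
  have key : X.canAlong i ∘ₗ (rightExtend A i).lTensor X =
      e'.toLinearMap ∘ₗ X.can.rTensor A ∘ₗ e.toLinearMap := by
    ext x y a
    change X.coactAlong i x * (1 ⊗ₜ (i y * (1 ⊗ₜ a))) = (rightExtend A i).lTensor H
      (TensorProduct.assoc k H X A ((X.coact x * (1 ⊗ₜ y)) ⊗ₜ a))
    rw [LeftComoduleAlgebra.coactAlong, AlgHom.comp_apply]
    induction X.coact x with
    | zero => simp
    | add x y hx hy => simp only [map_add, TensorProduct.add_tmul, add_mul, hx, hy]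
    | tmul h x => simp [rightExtend_tmul, mul_assoc]
  have h1 : Function.Bijective (e'.toLinearMap ∘ₗ X.can.rTensor A ∘ₗ e.toLinearMap) := by
    rw [← key, LinearMap.coe_comp]
    exact hc.comp (θ.lTensor X).bijective
  have h2 : Function.Bijective (X.can.rTensor A) := by
    rw [LinearMap.coe_comp, LinearMap.coe_comp] at h1
    exact (Function.Bijective.of_comp_iff _ e.bijective).mp
      ((Function.Bijective.of_comp_iff' e'.bijective _).mp h1)
  rw [← Module.FaithfullyFlat.lTensor_bijective_iff_bijective k A X.can]
  have h3 : X.can.lTensor A = (TensorProduct.comm k _ _).toLinearMap ∘ₗ X.can.rTensor A ∘ₗ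
      (TensorProduct.comm k _ _).toLinearMap := by
    ext; rfl
  rw [h3, LinearMap.coe_comp, LinearMap.coe_comp]
  exact (TensorProduct.comm k _ _).bijective.comp (h2.comp (TensorProduct.comm k _ _).bijective)

/-- Cotensoring with a bi-Galois object preserves and reflects Galois objects. -/
lemma IsCotensor.isGaloisObject_iff (hZ : Z.IsBiGaloisObject) (h : Z.IsCotensor A X i) :
    X.IsGaloisObject ↔ A.IsGaloisObject := by
  have := hZ.left.faithfullyFlat
  let μ := LinearEquiv.ofBijective _ (h.bijective_extend hZ.bijective_rcan)
  constructor
  · intro hX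
    have := hX.faithfullyFlat
    refine A.isGaloisObject_iff.mpr ⟨(h.bijective_rightExtend_iff hZ.bijective_rcan).mp
      (h.bijective_rightExtend hZ.left hX), ?_⟩
    have := Module.FaithfullyFlat.tensorProduct (k := k) Z.carrier X
    have := Module.FaithfullyFlat.of_linearEquiv k _ μ.symm
    exact Module.FaithfullyFlat.of_tensorProduct (k := k) Z.carrier A
  · intro hA
    have := hA.faithfullyFlat
    refine X.isGaloisObject_iff.mpr ⟨h.bijective_can hZ.left.bijective_can
      ((h.bijective_rightExtend_iff hZ.bijective_rcan).mpr hA.bijective_can), ?_⟩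
    have := Module.FaithfullyFlat.tensorProduct (k := k) Z.carrier A
    have := Module.FaithfullyFlat.of_linearEquiv k _ μ
    exact Module.FaithfullyFlat.of_tensorProduct (k := k) Z.carrier X

end Galois

end BicomoduleAlgebra

/-! ### Cotensor products and isomorphisms -/

section OpMul

variable {k : Type u} [CommRing k] {V B P : Type u} [Ring V] [Algebra k V] [Ring B] [Algebra k B]
  [Ring P] [Algebra k P] (j : V →ₐ[k] P) (f : B →ₐ[k] P)

/-- The linear map `Vᵐᵒᵖ ⊗ B → P`, `v ⊗ b ↦ j v * f b`. -/
def AlgHom.opMul : Vᵐᵒᵖ ⊗[k] B →ₗ[k] P :=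
  LinearMap.mulTensor (j.toLinearMap ∘ₗ (MulOpposite.opLinearEquiv k).symm.toLinearMap)
    f.toLinearMap

/-- The linear isomorphism `Vᵐᵒᵖ ⊗ B ≃ V ⊗ B` forgetting the opposite multiplication. -/
def unopTensor (k V B : Type u) [CommRing k] [Ring V] [Algebra k V] [Ring B] [Algebra k B] :
    Vᵐᵒᵖ ⊗[k] B ≃ₗ[k] V ⊗[k] B :=
  (MulOpposite.opLinearEquiv k).symm.rTensor B

lemma unopTensor_tmul (v : Vᵐᵒᵖ) (b : B) : unopTensor k V B (v ⊗ₜ b) = v.unop ⊗ₜ b := rfl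

lemma AlgHom.opMul_eq (t : Vᵐᵒᵖ ⊗[k] B) :
    j.opMul f t = LinearMap.mulTensor j.toLinearMap f.toLinearMap (unopTensor k V B t) := by
  induction t with
  | zero => simp
  | add x y hx hy => simp only [map_add, hx, hy]
  | tmul v b => rfl

lemma AlgHom.opMul_mul_tmul (t : Vᵐᵒᵖ ⊗[k] B) (v : Vᵐᵒᵖ) (b : B) :
    j.opMul f (t * (v ⊗ₜ b)) = j v.unop * j.opMul f t * f b := by
  induction t with
  | zero => simp
  | add x y hx hy => simp only [map_add, add_mul, mul_add, hx, hy]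
  | tmul w c =>
    simp [opMul, mul_assoc]

/-- `opMul` is multiplicative as soon as the first factor is sent to an element commuting with the
image of `V`. -/
lemma AlgHom.opMul_mul {s : Vᵐᵒᵖ ⊗[k] B} (hs : ∀ v, Commute (j.opMul f s) (j v))
    (t : Vᵐᵒᵖ ⊗[k] B) : j.opMul f (s * t) = j.opMul f s * j.opMul f t := by
  induction t with
  | zero => simp
  | add x y hx hy => simp only [map_add, mul_add, hx, hy]
  | tmul v b =>
    rw [opMul_mul_tmul, ← (hs v.unop).eq, mul_assoc]
    rfl

lemma AlgHom.opMul_one : j.opMul f 1 = 1 := by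
  change j 1 * f 1 = 1
  simp

lemma unopTensor_one : unopTensor k V B 1 = 1 := rfl

lemma LinearMap.mulTensor_mul (v : V) (p : V ⊗[k] B) :
    LinearMap.mulTensor j.toLinearMap f.toLinearMap ((v ⊗ₜ 1) * p) =
      j v * LinearMap.mulTensor j.toLinearMap f.toLinearMap p := by
  induction p with
  | zero => simp
  | add x y hx hy => simp only [map_add, mul_add, hx, hy]
  | tmul w b => simp [mul_assoc]

end OpMul

namespace LeftComoduleAlgebra

variable {k H : Type u} [CommRing k] [Ring H] [Bialgebra k H] (X Y : LeftComoduleAlgebra k H)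

/-- The diagonal coaction `x ⊗ y ↦ x₍₋₁₎ y₍₋₁₎ ⊗ (x₍₀₎ ⊗ y₍₀₎)` of `X ⊗ Y`. It is only linear. -/
def diagCoact : X ⊗[k] Y →ₗ[k] H ⊗[k] (X ⊗[k] Y) :=
  LinearMap.mulTensor
    (X.coactAlong (Algebra.TensorProduct.includeLeft : X →ₐ[k] X ⊗[k] Y)).toLinearMap
    (Y.coactAlong (Algebra.TensorProduct.includeRight : Y →ₐ[k] X ⊗[k] Y)).toLinearMap

variable {X Y}

lemma lTensor_mulTensor_diagCoact {P : Type u} [Ring P] [Algebra k P] (j : X →ₐ[k] P)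
    (f : Y →ₐ[k] P) (t : X ⊗[k] Y) :
    (LinearMap.mulTensor j.toLinearMap f.toLinearMap).lTensor H (X.diagCoact Y t) =
      LinearMap.mulTensor (X.coactAlong j).toLinearMap (Y.coactAlong f).toLinearMap t := by
  induction t with
  | zero => simp
  | add x y hx hy => simp only [map_add, hx, hy]
  | tmul x y =>
    simp only [diagCoact, LinearMap.mulTensor_tmul, AlgHom.toLinearMap_apply, coactAlong,
      AlgHom.comp_apply]
    induction X.coact x with
    | zero => simp
    | add s t hs ht => simp only [map_add, add_mul, hs, ht]
    | tmul h x =>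
      induction Y.coact y with
      | zero => simp
      | add s t hs ht => simp only [map_add, mul_add, hs, ht]
      | tmul h' y => simp

lemma coactLeft_tmul_one (W : Type u) [Ring W] [Algebra k W] (x : X) :
    X.coactLeft W (x ⊗ₜ 1) = X.coactAlong Algebra.TensorProduct.includeLeft x := by
  rw [coactLeft_tmul, ← Algebra.TensorProduct.one_def, ← Algebra.TensorProduct.one_def, mul_one]

end LeftComoduleAlgebra

namespace BicomoduleAlgebra

variable {k H K : Type u} [CommRing k] [Ring H] [Bialgebra k H] [Ring K] [Bialgebra k K]
  {Z : BicomoduleAlgebra k H K} {A A' : LeftComoduleAlgebra k K}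
  {X X' : LeftComoduleAlgebra k H} {i : X →ₐ[k] Z.carrier ⊗[k] A}
  {i' : X →ₐ[k] Z.carrier ⊗[k] A'}

lemma rcoactRight_map (Z : BicomoduleAlgebra k H K) {W W' : Type u} [Ring W] [Algebra k W]
    [Ring W'] [Algebra k W'] (f : W →ₐ[k] W') (v : Z.carrier ⊗[k] W) :
    Z.rcoactRight W' (Algebra.TensorProduct.map (AlgHom.id k Z.carrier) f v) =
      Algebra.TensorProduct.map (AlgHom.id k Z.carrier)
        (Algebra.TensorProduct.map (AlgHom.id k K) f) (Z.rcoactRight W v) := by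
  induction v with
  | zero => simp
  | add x y hx hy => simp only [map_add, hx, hy]
  | tmul z a =>
    simp only [rcoactRight, AlgHom.comp_apply, Algebra.TensorProduct.map_tmul, AlgHom.id_apply]
    induction Z.rcoact z with
    | zero => simp
    | add x y hx hy => simp only [map_add, TensorProduct.add_tmul, hx, hy]
    | tmul z c => simp

/-- `Z ⊗ X → Z ⊗ A` is colinear for the diagonal coaction of `Z ⊗ X` and `δ_Z ⊗ id`. -/
lemma coactLeft_extend {W : Type u} [Ring W] [Algebra k W] (f : X →ₐ[k] Z.carrier ⊗[k] W)
    (hf : ∀ x, Z.coactLeft W (f x) = X.coactAlong f x) (t : Z.carrier ⊗[k] X) :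
    Z.coactLeft W (LinearMap.mulTensor (Algebra.TensorProduct.includeLeft :
        Z.carrier →ₐ[k] Z.carrier ⊗[k] W).toLinearMap f.toLinearMap t) =
      (LinearMap.mulTensor (Algebra.TensorProduct.includeLeft :
        Z.carrier →ₐ[k] Z.carrier ⊗[k] W).toLinearMap f.toLinearMap).lTensor H
        (Z.diagCoact X t) := by
  rw [LeftComoduleAlgebra.lTensor_mulTensor_diagCoact]
  induction t with
  | zero => simp
  | add x y hx hy => simp only [map_add, hx, hy]
  | tmul z x =>
    simp only [LinearMap.mulTensor_tmul, AlgHom.toLinearMap_apply, map_mul, hf,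
      Algebra.TensorProduct.includeLeft_apply, LeftComoduleAlgebra.coactLeft_tmul_one]

lemma commute_one_tmul {V W : Type u} [Ring V] [Algebra k V] [Ring W] [Algebra k W] (v : V)
    (w : W) : Commute ((1 : V) ⊗ₜ[k] w) (v ⊗ₜ[k] 1) := by
  simp [Commute, SemiconjBy]

/-- Two comodule algebras `A`, `A'` with the same cotensor product `X` are related by a colinear
algebra map: the map `Z ⊗ A ← Z ⊗ X → Z ⊗ A'` is colinear for the coaction of `Z`, so it restricts
to a map `1 ⊗ A → 1 ⊗ A'` of coinvariants. Multiplicativity comes from comparing the middle term with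
`Zᵐᵒᵖ ⊗ X`. -/
lemma IsCotensor.exists_algHom (hZ : Z.IsBiGaloisObject) (h : Z.IsCotensor A X i)
    (h' : Z.IsCotensor A' X i') :
    ∃ g : A →ₐ[k] A', (∀ t a, Z.extend A i.toLinearMap t = 1 ⊗ₜ a →
        Z.extend A' i'.toLinearMap t = 1 ⊗ₜ g a) ∧
      ∀ a, A'.coact (g a) = Algebra.TensorProduct.map (AlgHom.id k K) g (A.coact a) := by
  have := hZ.left.faithfullyFlat
  let μ := LinearEquiv.ofBijective _ (h.bijective_extend hZ.bijective_rcan)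
  have hμ : ∀ v, Z.extend A i.toLinearMap (μ.symm v) = v := μ.apply_symm_apply
  have inj := Module.FaithfullyFlat.one_tmul_injective (k := k) Z.carrier A'
  have hdiag : ∀ a, Z.diagCoact X (μ.symm (1 ⊗ₜ a)) = 1 ⊗ₜ μ.symm (1 ⊗ₜ a) := by
    intro a
    apply (μ.lTensor H).injective
    refine (coactLeft_extend i (fun x => (h.coactAlong_eq x).symm) _).symm.trans ?_
    change Z.coactLeft A (Z.extend A i.toLinearMap (μ.symm (1 ⊗ₜ a))) =
      1 ⊗ₜ Z.extend A i.toLinearMap (μ.symm (1 ⊗ₜ a))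
    rw [hμ, LeftComoduleAlgebra.coactLeft_tmul, map_one, one_mul]
  have hex : ∀ a, ∃ a', Z.extend A' i'.toLinearMap (μ.symm (1 ⊗ₜ a)) = 1 ⊗ₜ a' := by
    intro a
    refine Z.exists_one_tmul_eq_of_coactLeft hZ.left.bijective_can ?_
    refine (coactLeft_extend i' (fun x => (h'.coactAlong_eq x).symm) _).trans ?_
    rw [hdiag]
    rfl
  choose g hg using hex
  let jA : Z.carrier →ₐ[k] Z.carrier ⊗[k] A := Algebra.TensorProduct.includeLeft
  let jA' : Z.carrier →ₐ[k] Z.carrier ⊗[k] A' := Algebra.TensorProduct.includeLeft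
  have hmul : ∀ a b, μ.symm (1 ⊗ₜ (a * b)) = unopTensor k Z.carrier X
      ((unopTensor k Z.carrier X).symm (μ.symm (1 ⊗ₜ a)) *
        (unopTensor k Z.carrier X).symm (μ.symm (1 ⊗ₜ b))) := by
    intro a b
    rw [LinearEquiv.symm_apply_eq]
    have hop : ∀ a, jA.opMul i ((unopTensor k Z.carrier X).symm (μ.symm (1 ⊗ₜ a))) = 1 ⊗ₜ a := by
      intro a
      rw [AlgHom.opMul_eq, LinearEquiv.apply_symm_apply]
      exact hμ _
    refine Eq.trans ?_ (jA.opMul_eq i _)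
    rw [AlgHom.opMul_mul _ _ (fun v => by rw [hop]; exact commute_one_tmul v a), hop, hop]
    simp
  have hop : ∀ a, jA'.opMul i' ((unopTensor k Z.carrier X).symm (μ.symm (1 ⊗ₜ a))) =
      1 ⊗ₜ g a := by
    intro a
    rw [AlgHom.opMul_eq, LinearEquiv.apply_symm_apply]
    exact hg _
  let G : A →ₐ[k] A' := AlgHom.ofLinearMap
    { toFun := g
      map_add' := fun a b => inj (by
        simp only [TensorProduct.mk_apply, TensorProduct.tmul_add, ← hg, map_add])
      map_smul' := fun c a => inj (by
        simp only [TensorProduct.mk_apply, TensorProduct.tmul_smul, ← hg, map_smul,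
          RingHom.id_apply]) }
    (inj (by
      have h1 : μ.symm (1 ⊗ₜ 1) = 1 ⊗ₜ 1 := by
        rw [LinearEquiv.symm_apply_eq]
        change _ = (1 ⊗ₜ 1) * i 1
        rw [map_one, mul_one]
      refine (hg 1).symm.trans ?_
      rw [h1, extend_tmul, AlgHom.toLinearMap_apply, map_one, mul_one]
      rfl))
    (fun a b => inj (by
      refine (hg (a * b)).symm.trans ?_
      rw [hmul]
      refine (jA'.opMul_eq i' _).symm.trans ?_
      rw [AlgHom.opMul_mul _ _ (fun v => by rw [hop]; exact commute_one_tmul v _), hop, hop]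
      simp))
  have hE : ∀ v, Z.extend A' i'.toLinearMap (μ.symm v) =
      Algebra.TensorProduct.map (AlgHom.id k Z.carrier) G v := by
    intro v
    induction v with
    | zero => simp
    | add x y hx hy => simp only [map_add, hx, hy]
    | tmul z a =>
      have h1 : μ.symm (z ⊗ₜ a) = (z ⊗ₜ 1) * μ.symm (1 ⊗ₜ a) := by
        rw [LinearEquiv.symm_apply_eq]
        refine Eq.trans ?_ (LinearMap.mulTensor_mul jA i z _).symm
        change _ = _ * Z.extend A i.toLinearMap _
        rw [hμ]
        simp [jA]
      rw [h1]
      refine (LinearMap.mulTensor_mul jA' i' z _).trans ?_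
      change _ * Z.extend A' i'.toLinearMap _ = _
      rw [hg]
      simp [jA', G]
  have hi : ∀ x, i' x = Algebra.TensorProduct.map (AlgHom.id k Z.carrier) G (i x) := by
    intro x
    rw [← hE]
    have h1 : μ.symm (i x) = 1 ⊗ₜ x := by
      rw [LinearEquiv.symm_apply_eq]
      exact (one_mul _).symm
    rw [h1]
    exact (one_mul _).symm
  refine ⟨G, fun t a hta => ?_, fun a => ?_⟩
  · have h1 : t = μ.symm (1 ⊗ₜ a) := by rw [LinearEquiv.eq_symm_apply]; exact hta
    rw [h1]
    exact hg a
  · have key : ∀ t, Algebra.TensorProduct.map (AlgHom.id k Z.carrier) (A'.coact.comp G)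
        (Z.extend A i.toLinearMap t) = Algebra.TensorProduct.map (AlgHom.id k Z.carrier)
        ((Algebra.TensorProduct.map (AlgHom.id k K) G).comp A.coact)
        (Z.extend A i.toLinearMap t) := by
      intro t
      induction t with
      | zero => simp
      | add x y hx hy => simp only [map_add, hx, hy]
      | tmul z x =>
        rw [extend_tmul, map_mul, map_mul]
        congr 1
        · simp
        · have e1 : Z.rcoactRight A (i x) = Z.idCoact A (i x) := (h.mem_range_iff _).mp ⟨x, rfl⟩
          have e2 : Z.rcoactRight A' (i' x) = Z.idCoact A' (i' x) :=
            (h'.mem_range_iff _).mp ⟨x, rfl⟩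
          rw [hi, rcoactRight_map, e1] at e2
          simp only [idCoact, Algebra.TensorProduct.map_id_map_id] at e2
          exact e2.symm
    have h1 := key (μ.symm (1 ⊗ₜ a))
    rw [hμ] at h1
    simp only [Algebra.TensorProduct.map_tmul, map_one, AlgHom.comp_apply] at h1
    exact Module.FaithfullyFlat.one_tmul_injective Z.carrier (K ⊗[k] A') h1

/-- A comodule algebra is determined up to isomorphism by its cotensor product with a bi-Galois
object. -/
lemma IsCotensor.isomorphic_left (hZ : Z.IsBiGaloisObject) (h : Z.IsCotensor A X i)
    (h' : Z.IsCotensor A' X i') : A.Isomorphic A' := by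
  have := hZ.left.faithfullyFlat
  obtain ⟨g, hg, hgc⟩ := h.exists_algHom hZ h'
  obtain ⟨g', hg', -⟩ := h'.exists_algHom hZ h
  have h1 : ∀ a, g' (g a) = a := fun a => by
    obtain ⟨t, ht⟩ := (h.bijective_extend hZ.bijective_rcan).2 (1 ⊗ₜ a)
    exact (Module.FaithfullyFlat.one_tmul_injective (k := k) Z.carrier A
      (ht.symm.trans (hg' _ _ (hg _ _ ht)))).symm
  have h2 : ∀ a, g (g' a) = a := fun a => by
    obtain ⟨t, ht⟩ := (h'.bijective_extend hZ.bijective_rcan).2 (1 ⊗ₜ a)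
    exact (Module.FaithfullyFlat.one_tmul_injective (k := k) Z.carrier A'
      (ht.symm.trans (hg _ _ (hg' _ _ ht)))).symm
  exact ⟨AlgEquiv.ofAlgHom g g' (AlgHom.ext h2) (AlgHom.ext h1), hgc⟩

/-- Cotensor products are unique up to isomorphism. -/
lemma IsCotensor.isomorphic_right (hH : Module.Flat k H) {i'' : X' →ₐ[k] Z.carrier ⊗[k] A}
    (h : Z.IsCotensor A X i) (h' : Z.IsCotensor A X' i'') : X.Isomorphic X' := by
  have hr : i.range = i''.range := by
    ext y
    exact (h.mem_range_iff y).trans (h'.mem_range_iff y).symm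
  let e : X ≃ₐ[k] X' := (AlgEquiv.ofInjective i h.injective).trans
    ((Subalgebra.equivOfEq _ _ hr).trans (AlgEquiv.ofInjective i'' h'.injective).symm)
  have he : ∀ x, i'' (e x) = i x := fun x =>
    congrArg Subtype.val (AlgEquiv.apply_symm_apply (AlgEquiv.ofInjective i'' h'.injective)
      (Subalgebra.equivOfEq _ _ hr (AlgEquiv.ofInjective i h.injective x)))
  refine ⟨e, fun x => ?_⟩
  apply Module.Flat.lTensor_preserves_injective_linearMap (M := H) i''.toLinearMap h'.injective
  change Algebra.TensorProduct.map (AlgHom.id k H) i'' _ =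
    Algebra.TensorProduct.map (AlgHom.id k H) i'' _
  have : i''.comp (e : (X : Type u) →ₐ[k] X') = i := AlgHom.ext he
  rw [← h'.coact, he, h.coact, Algebra.TensorProduct.map_id_map_id, this]

lemma IsCotensor.of_isomorphic_right (h : Z.IsCotensor A X i) (hX : X'.Isomorphic X) :
    ∃ i'', Z.IsCotensor A X' i'' := by
  obtain ⟨e, he⟩ := hX
  refine ⟨i.comp e, h.injective.comp e.injective, fun y => ?_, fun x => ?_⟩
  · rw [← h.mem_range_iff]
    constructor
    · rintro ⟨x, rfl⟩
      exact ⟨e x, rfl⟩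
    · rintro ⟨x, rfl⟩
      exact ⟨e.symm x, congrArg i (e.apply_symm_apply x)⟩
  · change Z.coactId A (i (e x)) = _
    rw [h.coact, he, Algebra.TensorProduct.map_id_map_id]

lemma IsCotensor.of_isomorphic_left (h : Z.IsCotensor A X i) (hA : A.Isomorphic A') :
    ∃ i'', Z.IsCotensor A' X i'' := by
  obtain ⟨e, he⟩ := hA
  let f : Z.carrier ⊗[k] A ≃ₐ[k] Z.carrier ⊗[k] A' :=
    Algebra.TensorProduct.congr AlgEquiv.refl e
  let F : Z.carrier ⊗[k] (K ⊗[k] A) ≃ₐ[k] Z.carrier ⊗[k] (K ⊗[k] A') :=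
    Algebra.TensorProduct.congr AlgEquiv.refl (Algebra.TensorProduct.congr AlgEquiv.refl e)
  have h1 : ∀ y, Z.rcoactId A' (f y) = F (Z.rcoactId A y) :=
    Z.rcoactRight_map (e : (A : Type u) →ₐ[k] A')
  have h2 : ∀ y, Z.idCoact A' (f y) = F (Z.idCoact A y) := by
    intro y
    induction y with
    | zero => simp
    | add x y hx hy => simp only [map_add, hx, hy]
    | tmul z a => exact congrArg (z ⊗ₜ[k] ·) (he a)
  refine ⟨f.toAlgHom.comp i, f.injective.comp h.injective, fun y => ?_, fun x => ?_⟩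
  · obtain ⟨y, rfl⟩ := f.surjective y
    rw [h1, h2, F.injective.eq_iff, ← h.mem_range_iff]
    exact ⟨fun ⟨x, hx⟩ => ⟨x, f.injective hx⟩, fun ⟨x, hx⟩ => ⟨x, congrArg f hx⟩⟩
  · refine (Z.coactLeft_map (e : (A : Type u) →ₐ[k] A') (i x)).trans ?_
    rw [← coactId_eq_coactLeft, h.coact, Algebra.TensorProduct.map_id_map_id]
    rfl

/-- Two comodule algebras are isomorphic if and only if their cotensor products with a bi-Galois
object are. -/
lemma IsCotensor.isomorphic_iff (hZ : Z.IsBiGaloisObject) {i'' : X' →ₐ[k] Z.carrier ⊗[k] A'}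
    (h : Z.IsCotensor A X i) (h' : Z.IsCotensor A' X' i'') :
    X.Isomorphic X' ↔ A.Isomorphic A' := by
  constructor
  · intro hX
    obtain ⟨_, h1⟩ := h'.of_isomorphic_right hX
    exact h.isomorphic_left hZ h1
  · intro hA
    obtain ⟨_, h1⟩ := h.of_isomorphic_left hA
    exact h1.isomorphic_right hZ.left.flat h'

end BicomoduleAlgebra

/-! ### Coinvariants of a diagonal coaction -/

lemma unopTensor_mul_tmul {k V B : Type u} [CommRing k] [Ring V] [Algebra k V] [Ring B]
    [Algebra k B] (s : Vᵐᵒᵖ ⊗[k] B) (v : Vᵐᵒᵖ) (b : B) :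
    unopTensor k V B (s * (v ⊗ₜ b)) = (v.unop ⊗ₜ 1) * unopTensor k V B s * (1 ⊗ₜ b) := by
  induction s with
  | zero => simp
  | add x y hx hy => simp only [map_add, add_mul, mul_add, hx, hy]
  | tmul w c => simp [unopTensor_tmul]

/-- The action of `Vᵐᵒᵖ ⊗ B` on `V ⊗ B`, by right multiplication of `V` and left multiplication
of `B`. -/
def unopTensorAct {k V B : Type u} [CommRing k] [Ring V] [Algebra k V] [Ring B]
    [Algebra k B] (s : Vᵐᵒᵖ ⊗[k] B) : V ⊗[k] B →ₗ[k] V ⊗[k] B :=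
  (unopTensor k V B).toLinearMap ∘ₗ LinearMap.mulLeft k s ∘ₗ (unopTensor k V B).symm.toLinearMap

lemma unopTensorAct_tmul {k V B : Type u} [CommRing k] [Ring V] [Algebra k V] [Ring B]
    [Algebra k B] (s : Vᵐᵒᵖ ⊗[k] B) (v : V) (b : B) :
    unopTensorAct s (v ⊗ₜ b) = (v ⊗ₜ 1) * unopTensor k V B s * (1 ⊗ₜ b) :=
  unopTensor_mul_tmul s (MulOpposite.op v) b

lemma unopTensorAct_unopTensor {k V B : Type u} [CommRing k] [Ring V] [Algebra k V] [Ring B]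
    [Algebra k B] (s t : Vᵐᵒᵖ ⊗[k] B) :
    unopTensorAct s (unopTensor k V B t) = unopTensor k V B (s * t) := by
  simp [unopTensorAct]

lemma unopTensorAct_mul {k V B : Type u} [CommRing k] [Ring V] [Algebra k V] [Ring B]
    [Algebra k B] (s : Vᵐᵒᵖ ⊗[k] B) (v : V) (p : V ⊗[k] B) :
    unopTensorAct s ((v ⊗ₜ 1) * p) = (v ⊗ₜ 1) * unopTensorAct s p := by
  induction p with
  | zero => simp
  | add x y hx hy => simp only [map_add, mul_add, hx, hy]
  | tmul w b => simp [unopTensorAct_tmul, ← mul_assoc]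

namespace LeftComoduleAlgebra

variable {k H : Type u} [CommRing k] [Ring H] [Bialgebra k H] (X Y : LeftComoduleAlgebra k H)

lemma assoc_comul_coactAlong {P : Type u} [Ring P] [Algebra k P] (j : X →ₐ[k] P) (x : X) :
    Algebra.TensorProduct.assoc k k k H H P
      (Algebra.TensorProduct.map (Bialgebra.comulAlgHom k H) (AlgHom.id k P) (X.coactAlong j x)) =
      Algebra.TensorProduct.map (AlgHom.id k H) (X.coactAlong j) (X.coact x) := by
  have h1 : Algebra.TensorProduct.map (AlgHom.id k H) (X.coactAlong j) (X.coact x) =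
      Algebra.TensorProduct.map (AlgHom.id k H) (Algebra.TensorProduct.map (AlgHom.id k H) j)
        (Algebra.TensorProduct.map (AlgHom.id k H) X.coact (X.coact x)) := by
    rw [Algebra.TensorProduct.map_id_map_id]
    rfl
  rw [h1, ← X.coassoc, coactAlong, AlgHom.comp_apply]
  induction X.coact x with
  | zero => simp
  | add x y hx hy => simp only [map_add, hx, hy]
  | tmul h y =>
    simp only [Algebra.TensorProduct.map_tmul, AlgHom.id_apply, Bialgebra.comulAlgHom_apply]
    induction Coalgebra.comul (R := k) h with
    | zero => simp
    | add x y hx hy => simp only [map_add, TensorProduct.add_tmul, hx, hy]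
    | tmul a b => simp

lemma lid_counit_coactAlong {P : Type u} [Ring P] [Algebra k P] (j : X →ₐ[k] P) (x : X) :
    Algebra.TensorProduct.lid k P
      (Algebra.TensorProduct.map (Bialgebra.counitAlgHom k H) (AlgHom.id k P) (X.coactAlong j x)) =
      j x := by
  conv_rhs => rw [← X.counit x]
  rw [coactAlong, AlgHom.comp_apply]
  induction X.coact x with
  | zero => simp
  | add x y hx hy => simp only [map_add, hx, hy]
  | tmul h y => simp

lemma diagCoact_coassoc (t : X ⊗[k] Y) :
    TensorProduct.assoc k H H (X ⊗[k] Y)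
      ((Coalgebra.comul (R := k) (A := H)).rTensor (X ⊗[k] Y) (X.diagCoact Y t)) =
      (X.diagCoact Y).lTensor H (X.diagCoact Y t) := by
  change Algebra.TensorProduct.assoc k k k H H (X ⊗[k] Y) (Algebra.TensorProduct.map
    (Bialgebra.comulAlgHom k H) (AlgHom.id k (X ⊗[k] Y)) (X.diagCoact Y t)) = _
  refine Eq.trans ?_ (lTensor_mulTensor_diagCoact _ _ t).symm
  induction t with
  | zero => simp
  | add x y hx hy => simp only [map_add, hx, hy]
  | tmul x y =>
    simp only [diagCoact, LinearMap.mulTensor_tmul, AlgHom.toLinearMap_apply, map_mul,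
      assoc_comul_coactAlong]
    rfl

lemma diagCoact_counit (t : X ⊗[k] Y) :
    TensorProduct.lid k (X ⊗[k] Y)
      ((Coalgebra.counit (R := k) (A := H)).rTensor (X ⊗[k] Y) (X.diagCoact Y t)) = t := by
  change Algebra.TensorProduct.lid k (X ⊗[k] Y) (Algebra.TensorProduct.map
    (Bialgebra.counitAlgHom k H) (AlgHom.id k (X ⊗[k] Y)) (X.diagCoact Y t)) = _
  induction t with
  | zero => simp
  | add x y hx hy => simp only [map_add, hx, hy]
  | tmul x y =>
    simp only [diagCoact, LinearMap.mulTensor_tmul, AlgHom.toLinearMap_apply, map_mul,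
      lid_counit_coactAlong]
    simp

lemma diagCoact_one_tmul (y : Y) :
    X.diagCoact Y (1 ⊗ₜ y) = Y.coactAlong Algebra.TensorProduct.includeRight y := by
  simp [diagCoact]

/-- The algebra `(Xᵐᵒᵖ ⊗ Y)^{co H}` of coinvariants for the diagonal coaction. It is closed under
multiplication only with the opposite multiplication on the first factor. -/
def diagCoinvariants : Subalgebra k ((X : Type u)ᵐᵒᵖ ⊗[k] Y) where
  carrier := {t | X.diagCoact Y (unopTensor k X Y t) = 1 ⊗ₜ unopTensor k X Y t}
  mul_mem' {s t} hs ht := by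
    have hs : X.diagCoact Y (unopTensor k X Y s) = 1 ⊗ₜ unopTensor k X Y s := hs
    have ht : X.diagCoact Y (unopTensor k X Y t) = 1 ⊗ₜ unopTensor k X Y t := ht
    have key : ∀ t, X.diagCoact Y (unopTensor k X Y (s * t)) =
        (unopTensorAct s).lTensor H (X.diagCoact Y (unopTensor k X Y t)) := by
      intro t
      induction t with
      | zero => simp
      | add x y hx hy => simp only [map_add, mul_add, hx, hy]
      | tmul x y =>
        have h1 := AlgHom.opMul_mul_tmul
          (X.coactAlong (Algebra.TensorProduct.includeLeft : X →ₐ[k] X ⊗[k] Y))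
          (Y.coactAlong (Algebra.TensorProduct.includeRight : Y →ₐ[k] X ⊗[k] Y)) s x y
        rw [AlgHom.opMul_eq, AlgHom.opMul_eq] at h1
        refine h1.trans ?_
        change _ * X.diagCoact Y _ * _ = _
        rw [hs]
        change _ = (unopTensorAct s).lTensor H (X.coactAlong _ x.unop * Y.coactAlong _ y)
        rw [coactAlong, coactAlong, AlgHom.comp_apply, AlgHom.comp_apply]
        induction X.coact x.unop with
        | zero => simp
        | add x y hx hy => simp only [map_add, add_mul, hx, hy]
        | tmul h x =>
          induction Y.coact y with
          | zero => simp
          | add x y hx hy => simp only [map_add, mul_add, hx, hy]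
          | tmul h' y => simp [unopTensorAct_tmul]
    change X.diagCoact Y _ = _
    rw [key, ht, LinearMap.lTensor_tmul, unopTensorAct_unopTensor]
  add_mem' {s t} hs ht := by
    simp only [Set.mem_ofPred_eq, map_add, TensorProduct.tmul_add] at hs ht ⊢
    rw [hs, ht]
  algebraMap_mem' c := by
    rw [Algebra.algebraMap_eq_smul_one, Set.mem_ofPred_eq, map_smul, map_smul, unopTensor_one,
      Algebra.TensorProduct.one_def, diagCoact_one_tmul, map_one, TensorProduct.tmul_smul]
    rfl

section counitMap

variable {X Y} {S : Type u} [Ring S] [Algebra k S] (ι : S →ₐ[k] (X : Type u)ᵐᵒᵖ ⊗[k] Y)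

/-- The map `X ⊗ S → X ⊗ Y`, `x ⊗ s ↦ x x' ⊗ y` where `ι s = x' ⊗ y`, for an algebra `S` over
`Xᵐᵒᵖ ⊗ Y`. -/
def counitMap : X ⊗[k] S →ₗ[k] X ⊗[k] Y :=
  LinearMap.mulTensor (Algebra.TensorProduct.includeLeft : X →ₐ[k] X ⊗[k] Y).toLinearMap
    ((unopTensor k X Y).toLinearMap ∘ₗ ι.toLinearMap)

lemma counitMap_tmul (x : X) (a : S) :
    counitMap ι (x ⊗ₜ a) = (x ⊗ₜ 1) * unopTensor k X Y (ι a) := rfl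

/-- The algebra `X ⊗ S` acts on `X ⊗ Y`, commuting with right multiplication
by `Y`; the counit map is the action on `1`. -/
lemma counitMap_mul (w v : X ⊗[k] S) (y : Y)
    (hv : counitMap ι v = 1 ⊗ₜ y) : counitMap ι (w * v) = counitMap ι w * (1 ⊗ₜ y) := by
  induction w with
  | zero => simp
  | add x y hx hy => simp only [map_add, add_mul, hx, hy]
  | tmul x a =>
    have key : ∀ v, counitMap ι ((x ⊗ₜ a) * v) =
        (x ⊗ₜ 1) * unopTensorAct (ι a) (counitMap ι v) := by
      intro v
      induction v with
      | zero => simp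
      | add x y hx hy => simp only [map_add, mul_add, hx, hy]
      | tmul z b =>
        rw [counitMap_tmul, unopTensorAct_mul, unopTensorAct_unopTensor,
          Algebra.TensorProduct.tmul_mul_tmul, counitMap_tmul, ← mul_assoc,
          Algebra.TensorProduct.tmul_mul_tmul, mul_one, map_mul]
    rw [key, hv, unopTensorAct_tmul, counitMap_tmul, ← Algebra.TensorProduct.one_def, one_mul,
      mul_assoc]

lemma counitMap_mul_left (x : X) (w : X ⊗[k] S) :
    counitMap ι ((x ⊗ₜ 1) * w) = (x ⊗ₜ 1) * counitMap ι w := by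
  induction w with
  | zero => simp
  | add x y hx hy => simp only [map_add, mul_add, hx, hy]
  | tmul z a => simp [counitMap_tmul, ← mul_assoc]

lemma diagCoact_counitMap
    (hι : ∀ a, X.diagCoact Y (unopTensor k X Y (ι a)) = 1 ⊗ₜ unopTensor k X Y (ι a))
    (w : X ⊗[k] S) :
    X.diagCoact Y (counitMap ι w) =
      (counitMap ι).lTensor H (X.coactLeft S w) := by
  induction w with
  | zero => simp
  | add x y hx hy => simp only [map_add, hx, hy]
  | tmul x a =>
    rw [counitMap_tmul, diagCoact, LinearMap.mulTensor_mul]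
    change _ * X.diagCoact Y _ = _
    rw [hι, coactLeft_tmul, coactAlong, coactAlong, AlgHom.comp_apply, AlgHom.comp_apply]
    induction X.coact x with
    | zero => simp
    | add x y hx hy => simp only [map_add, add_mul, hx, hy]
    | tmul h y => simp [counitMap_tmul]

section coev

variable (hc : Function.Bijective (counitMap ι))

/-- The algebra map `Y → X ⊗ S` sending `y` to the preimage of `1 ⊗ y` under the
counit map, when the latter is bijective. For `S = (Xᵐᵒᵖ ⊗ Y)^{co H}` it is
`y ↦ h' ⊗ (h'' ⊗ y₍₀₎)` with `h = y₍₋₁₎`, where `h' ⊗ h''` is the preimage of `h ⊗ 1` under the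
canonical map of `X`. -/
def coev : Y →ₐ[k] X ⊗[k] S :=
  let c := LinearEquiv.ofBijective _ hc
  have hcs : ∀ y, counitMap ι (c.symm (1 ⊗ₜ y)) = 1 ⊗ₜ y := fun y => c.apply_symm_apply _
  AlgHom.ofLinearMap (c.symm.toLinearMap ∘ₗ TensorProduct.mk k X Y 1)
    (hc.1 ((hcs 1).trans (by
      rw [Algebra.TensorProduct.one_def, counitMap_tmul, map_one, unopTensor_one, mul_one])))
    (fun y y' => hc.1 ((hcs (y * y')).trans (by
      refine Eq.trans ?_ (counitMap_mul ι _ _ y' (hcs y')).symm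
      refine Eq.trans ?_ (congrArg (· * _) (hcs y)).symm
      simp)))

lemma counitMap_coev (y : Y) : counitMap ι (coev ι hc y) = 1 ⊗ₜ y :=
  (LinearEquiv.ofBijective _ hc).apply_symm_apply _

/-- The inverse of the counit map is `x ⊗ y ↦ x • coev y`. -/
lemma mulTensor_coev_counitMap (w : X ⊗[k] S) :
    LinearMap.mulTensor (Algebra.TensorProduct.includeLeft :
      X →ₐ[k] X ⊗[k] S).toLinearMap (coev ι hc).toLinearMap
        (counitMap ι w) = w := by
  apply hc.1
  generalize counitMap ι w = v
  induction v with
  | zero => simp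
  | add x y hx hy => simp only [map_add, hx, hy]
  | tmul x y =>
    refine (counitMap_mul_left ι x _).trans ?_
    refine (congrArg _ (counitMap_coev ι hc y)).trans ?_
    simp

lemma coactLeft_coev
    (hι : ∀ a, X.diagCoact Y (unopTensor k X Y (ι a)) = 1 ⊗ₜ unopTensor k X Y (ι a)) (y : Y) :
    X.coactLeft S (coev ι hc y) = Y.coactAlong (coev ι hc) y := by
  apply ((LinearEquiv.ofBijective _ hc).lTensor H).injective
  change (counitMap ι).lTensor H _ = (counitMap ι).lTensor H _
  rw [← diagCoact_counitMap ι hι, counitMap_coev, diagCoact_one_tmul, coactAlong, coactAlong,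
    AlgHom.comp_apply, AlgHom.comp_apply]
  induction Y.coact y with
  | zero => simp
  | add x y hx hy => simp only [map_add, hx, hy]
  | tmul h y => simp [counitMap_coev]

end coev

end counitMap

/-- By the structure theorem for the Hopf module `X ⊗ Y`, the counit map is bijective. -/
lemma bijective_counitMap [Module.Flat k X] (hX : Function.Bijective X.can) :
    Function.Bijective (counitMap (X := X) (Y := Y) (S := X.diagCoinvariants Y)
      (X.diagCoinvariants Y).val) := by
  have hS := X.bijective_mulTensor_coinvariantsOf (X.diagCoact Y) hX
    Algebra.TensorProduct.includeLeft (X.diagCoact_coassoc Y) (X.diagCoact_counit Y)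
    (fun x p => by
      rw [diagCoact]
      exact LinearMap.mulTensor_mul _ _ x p)
  let e : X.diagCoinvariants Y ≃ₗ[k] coinvariantsOf (X.diagCoact Y) :=
    (unopTensor k X Y).ofSubmodules (Subalgebra.toSubmodule (X.diagCoinvariants Y)) _ (by
      ext t
      obtain ⟨t, rfl⟩ := (unopTensor k X Y).surjective t
      rw [mem_coinvariantsOf, Submodule.mem_map_equiv, LinearEquiv.symm_apply_apply]
      rfl)
  have h2 : counitMap (X := X) (Y := Y) (S := X.diagCoinvariants Y)
      (X.diagCoinvariants Y).val = LinearMap.mulTensor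
      (Algebra.TensorProduct.includeLeft : X →ₐ[k] X ⊗[k] Y).toLinearMap
      (coinvariantsOf (X.diagCoact Y)).subtype ∘ₗ e.toLinearMap.lTensor X := by
    ext; rfl
  rw [h2, LinearMap.coe_comp]
  exact hS.comp (e.lTensor X).bijective

end LeftComoduleAlgebra

/-! ### The inverse of the cotensor product -/

/-- An algebra with the trivial coaction `w ↦ 1 ⊗ w`. -/
def LeftComoduleAlgebra.trivial (k K W : Type u) [CommRing k] [Ring K] [Bialgebra k K] [Ring W]
    [Algebra k W] : LeftComoduleAlgebra k K where
  carrier := W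
  coact := Algebra.TensorProduct.includeRight
  coassoc a := by simp [Algebra.TensorProduct.one_def]
  counit a := by simp

namespace BicomoduleAlgebra

variable {k H K : Type u} [CommRing k] [Ring H] [Bialgebra k H] [Ring K] [Bialgebra k K]
  (Z : BicomoduleAlgebra k H K) (B : LeftComoduleAlgebra k H)

lemma coactLeft_rcoactRight (W : Type u) [Ring W] [Algebra k W] (v : Z.carrier ⊗[k] W) :
    Z.coactLeft (K ⊗[k] W) (Z.rcoactRight W v) =
      Algebra.TensorProduct.map (AlgHom.id k H) (Z.rcoactRight W) (Z.coactLeft W v) :=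
  Z.coactIdId_rcoactId (.trivial k K W) v

lemma counit_rcoactRight (W : Type u) [Ring W] [Algebra k W] (v : Z.carrier ⊗[k] W) :
    Algebra.TensorProduct.map (AlgHom.id k Z.carrier)
      ((Algebra.TensorProduct.lid k W).toAlgHom.comp
        (Algebra.TensorProduct.map (Bialgebra.counitAlgHom k K) (AlgHom.id k W)))
      (Z.rcoactRight W v) = v := by
  induction v with
  | zero => simp
  | add x y hx hy => simp only [map_add, hx, hy]
  | tmul z w =>
    conv_rhs => rw [← Z.rcounit z]
    simp only [rcoactRight, AlgHom.comp_apply, Algebra.TensorProduct.map_tmul, AlgHom.id_apply]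
    induction Z.rcoact z with
    | zero => simp
    | add x y hx hy => simp only [map_add, TensorProduct.add_tmul, hx, hy]
    | tmul z c => simp [TensorProduct.smul_tmul]

section inverse

open LeftComoduleAlgebra (counitMap coev counitMap_tmul counitMap_coev coactLeft_coev
  mulTensor_coev_counitMap)

variable {Z B} {S : Type u} [Ring S] [Algebra k S] (ι : S →ₐ[k] (Z.carrier)ᵐᵒᵖ ⊗[k] B)
  (hc : Function.Bijective (counitMap (X := Z.toLeftComoduleAlgebra) ι))

variable (Z) in
/-- The `k`-linear map `Z ⊗ B → Z ⊗ (K ⊗ S)`, `z ⊗ b ↦ (z ⊗ 1) (ρ ⊗ id)(coev b)`. Here `S` with its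
map to `Zᵐᵒᵖ ⊗ B` stands for the algebra of diagonal coinvariants; only the bijectivity of `counitMap`
and the coinvariance of the image of `S` are used. On `S` the map takes values in `1 ⊗ (K ⊗ S)`. -/
def preCoact : Z.carrier ⊗[k] B →ₗ[k] Z.carrier ⊗[k] (K ⊗[k] S) :=
  LinearMap.mulTensor (Algebra.TensorProduct.includeLeft :
      Z.carrier →ₐ[k] Z.carrier ⊗[k] (K ⊗[k] S)).toLinearMap
    ((Z.rcoactRight (S)).comp (coev ι hc)).toLinearMap

lemma preCoact_tmul (z : Z.carrier) (b : B) : Z.preCoact ι hc (z ⊗ₜ b) =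
    (z ⊗ₜ 1) * Z.rcoactRight (S) (coev ι hc b) := rfl

variable [Module.FaithfullyFlat k Z.carrier] (hZ : Function.Bijective Z.can)
  (hι : ∀ a, Z.diagCoact B (unopTensor k Z.carrier B (ι a)) = 1 ⊗ₜ unopTensor k Z.carrier B (ι a))
include hZ hι

lemma exists_preCoact_eq (a : S) :
    ∃ c, Z.preCoact ι hc (unopTensor k Z.carrier B (ι a)) = 1 ⊗ₜ c := by
  refine Z.exists_one_tmul_eq_of_coactLeft hZ ?_
  refine (coactLeft_extend ((Z.rcoactRight (S)).comp (coev ι hc))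
    (fun b => ?_) _).trans ?_
  · rw [AlgHom.comp_apply, coactLeft_rcoactRight, coactLeft_coev ι hc hι,
      LeftComoduleAlgebra.coactAlong, AlgHom.comp_apply, Algebra.TensorProduct.map_id_map_id]
    rfl
  · rw [hι]
    rfl

lemma exists_inverseCoact : ∃ g : S →ₐ[k] K ⊗[k] S,
    ∀ a, Z.preCoact ι hc (unopTensor k Z.carrier B (ι a)) = 1 ⊗ₜ g a := by
  choose g hg using exists_preCoact_eq ι hc hZ hι
  have inj := Module.FaithfullyFlat.one_tmul_injective (k := k) Z.carrier (K ⊗[k] S)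
  obtain ⟨f, hf⟩ : ∃ f, f = (Z.rcoactRight S).comp (coev ι hc) := ⟨_, rfl⟩
  obtain ⟨j, hj⟩ : ∃ j : Z.carrier →ₐ[k] Z.carrier ⊗[k] (K ⊗[k] S),
    j = Algebra.TensorProduct.includeLeft := ⟨_, rfl⟩
  have hop : ∀ a : S, j.opMul f (ι a) = 1 ⊗ₜ g a := fun a => by
    rw [hj, hf]
    exact (AlgHom.opMul_eq _ _ (ι a)).trans (hg a)
  have hadd : ∀ a b, g (a + b) = g a + g b := fun a b => inj <| by
    refine (hop (a + b)).symm.trans ?_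
    rw [map_add, map_add, hop, hop, TensorProduct.mk_apply, TensorProduct.tmul_add]
  have hsmul : ∀ (c : k) a, g (c • a) = c • g a := fun c a => inj <| by
    refine (hop (c • a)).symm.trans ?_
    rw [map_smul, map_smul, hop, TensorProduct.mk_apply, TensorProduct.tmul_smul]
  have hone : g 1 = 1 := inj <| by
    refine (hop 1).symm.trans ?_
    rw [map_one, AlgHom.opMul_one]
    rfl
  have hmul : ∀ a b, g (a * b) = g a * g b := fun a b => inj <| by
    refine (hop (a * b)).symm.trans ?_
    rw [map_mul, AlgHom.opMul_mul _ _ (fun v => by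
      rw [hop, hj]; exact commute_one_tmul v _), hop, hop, TensorProduct.mk_apply,
      Algebra.TensorProduct.tmul_mul_tmul, one_mul]
  exact ⟨AlgHom.ofLinearMap ⟨⟨g, hadd⟩, hsmul⟩ hone hmul, hg⟩

/-- The left `K`-coaction of `S`, the restriction of `preCoact` to `S`. -/
def inverseCoact : S →ₐ[k] K ⊗[k] S :=
  (exists_inverseCoact ι hc hZ hι).choose

lemma one_tmul_inverseCoact (a : S) :
    (1 : Z.carrier) ⊗ₜ[k] inverseCoact ι hc hZ hι a =
      Z.preCoact ι hc (unopTensor k Z.carrier B (ι a)) :=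
  ((exists_inverseCoact ι hc hZ hι).choose_spec a).symm

lemma preCoact_counitMap (w : Z.carrier ⊗[k] S) :
    Z.preCoact ι hc (counitMap ι w) =
      Algebra.TensorProduct.map (AlgHom.id k Z.carrier) (inverseCoact ι hc hZ hι) w := by
  induction w with
  | zero => simp
  | add x y hx hy => simp only [map_add, hx, hy]
  | tmul z a =>
    rw [counitMap_tmul]
    refine (LinearMap.mulTensor_mul _ _ z _).trans ?_
    change _ * Z.preCoact ι hc _ = _
    rw [← one_tmul_inverseCoact ι hc hZ hι]
    simp

/-- The image of `B → Z ⊗ S` equalizes the two coactions of `K`. -/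
lemma rcoactRight_coev (b : B) :
    Z.rcoactRight (S) (coev ι hc b) =
      Algebra.TensorProduct.map (AlgHom.id k Z.carrier) (inverseCoact ι hc hZ hι)
        (coev ι hc b) := by
  rw [← preCoact_counitMap ι hc hZ hι, counitMap_coev, preCoact_tmul]
  exact (one_mul _).symm

/-- The `K`-comodule algebra `S`, whose cotensor product with `Z` is `B`. -/
def inverseCotensor : LeftComoduleAlgebra k K where
  carrier := S
  coact := inverseCoact ι hc hZ hι
  coassoc a := by
    apply Module.FaithfullyFlat.one_tmul_injective (k := k) Z.carrier
    let F := Algebra.TensorProduct.map (AlgHom.id k Z.carrier)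
      ((Algebra.TensorProduct.assoc k k k K K (S)).toAlgHom.comp
        (Algebra.TensorProduct.map (Bialgebra.comulAlgHom k K)
          (AlgHom.id k (S))))
    let G := Algebra.TensorProduct.map (AlgHom.id k Z.carrier)
      (Algebra.TensorProduct.map (AlgHom.id k K) (inverseCoact ι hc hZ hι))
    have key : ∀ p, F (Z.preCoact ι hc p) = G (Z.preCoact ι hc p) := by
      intro p
      induction p with
      | zero => simp
      | add x y hx hy => simp only [map_add, hx, hy]
      | tmul z b =>
        rw [preCoact_tmul, map_mul, map_mul]
        congr 1
        · simp [F, G]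
        · refine (Z.rcoactRight_rcoactRight _ _).symm.trans ?_
          conv_lhs => rw [rcoactRight_coev ι hc hZ hι]
          exact Z.rcoactRight_map _ _
    have h1 := key (unopTensor k Z.carrier B (ι a))
    rw [← one_tmul_inverseCoact ι hc hZ hι] at h1
    simpa [F, G] using h1
  counit a := by
    apply Module.FaithfullyFlat.one_tmul_injective (k := k) Z.carrier
    let F := Algebra.TensorProduct.map (AlgHom.id k Z.carrier)
      ((Algebra.TensorProduct.lid k (S)).toAlgHom.comp
        (Algebra.TensorProduct.map (Bialgebra.counitAlgHom k K)
          (AlgHom.id k (S))))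
    have key : ∀ p, F (Z.preCoact ι hc p) = LinearMap.mulTensor (Algebra.TensorProduct.includeLeft :
      Z.carrier →ₐ[k] Z.carrier ⊗[k] S).toLinearMap
        (coev ι hc).toLinearMap p := by
      intro p
      induction p with
      | zero => simp
      | add x y hx hy => simp only [map_add, hx, hy]
      | tmul z b =>
        rw [preCoact_tmul, map_mul, counit_rcoactRight]
        simp [F]
    have h1 := key (unopTensor k Z.carrier B (ι a))
    have h2 : unopTensor k Z.carrier B (ι a) =
      counitMap (X := Z.toLeftComoduleAlgebra) ι (1 ⊗ₜ a) := (one_mul _).symm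
    rw [← one_tmul_inverseCoact ι hc hZ hι, h2, mulTensor_coev_counitMap] at h1
    simpa [F] using h1

/-- The algebra `B` is the cotensor product of `Z` with `inverseCotensor`. -/
lemma isCotensor_inverseCotensor (hZ' : Function.Bijective Z.rcan) :
    Z.IsCotensor (inverseCotensor ι hc hZ hι) B (coev ι hc) := by
  refine isCotensor_of_bijective_extend hZ' (rcoactRight_coev ι hc hZ hι)
    (coactLeft_coev ι hc hι) ?_
  have h2 : Function.LeftInverse _ (counitMap ι) := mulTensor_coev_counitMap ι hc
  have h3 := h2.eq_rightInverse (g₂ := (Equiv.ofBijective _ hc).symm)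
    (Equiv.ofBijective _ hc).apply_symm_apply
  have h4 := (Equiv.ofBijective _ hc).symm.bijective
  rw [← h3] at h4
  exact h4

end inverse

/-- Every `H`-comodule algebra is a cotensor product with the bi-Galois object `Z`, namely of the
algebra of coinvariants `(Zᵐᵒᵖ ⊗ B)^{co H}`. -/
lemma exists_isCotensor (hZ : Z.IsBiGaloisObject) : ∃ A i, Z.IsCotensor A B i := by
  have := hZ.left.faithfullyFlat
  have hc := Z.bijective_counitMap B hZ.left.bijective_can
  have hι : ∀ a : Z.diagCoinvariants B, Z.diagCoact B (unopTensor k Z.carrier B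
    ((Z.diagCoinvariants B).val a)) =
      1 ⊗ₜ unopTensor k Z.carrier B ((Z.diagCoinvariants B).val a) := fun a => a.2
  have h := isCotensor_inverseCotensor _ hc hZ.left.bijective_can hι hZ.bijective_rcan
  exact ⟨_, _, h⟩

end BicomoduleAlgebra

/-! ### Base change of bicomodule algebras -/

section baseChangeAux

open LeftComoduleAlgebra (baseChangeAux baseChangeAux_tmul)

variable {k : Type u} [CommRing k] (S : Type u) [CommRing S] [Algebra k S] (B C D : Type u)
  [Ring B] [Algebra k B] [Ring C] [Algebra k C] [Ring D] [Algebra k D]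

/-- The map `B ⊗ (C ⊗ D) → (S ⊗ B) ⊗_S ((S ⊗ C) ⊗_S (S ⊗ D))`. -/
def baseChangeAux₃ : B ⊗[k] (C ⊗[k] D) →ₗ[k] (S ⊗[k] B) ⊗[S] ((S ⊗[k] C) ⊗[S] (S ⊗[k] D)) :=
  TensorProduct.lift (LinearMap.mk₂ k
    (fun b w => ((1 : S) ⊗ₜ[k] b) ⊗ₜ[S] baseChangeAux S C D w)
    (fun _ _ _ => by simp only [TensorProduct.tmul_add, TensorProduct.add_tmul])
    (fun _ _ _ => by simp only [TensorProduct.tmul_smul, TensorProduct.smul_tmul'])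
    (fun _ _ _ => by simp only [map_add, TensorProduct.tmul_add])
    (fun _ _ _ => by simp only [map_smul, TensorProduct.tmul_smul]))

variable {B C D}

lemma baseChangeAux₃_tmul (b : B) (w : C ⊗[k] D) :
    baseChangeAux₃ S B C D (b ⊗ₜ w) = ((1 : S) ⊗ₜ[k] b) ⊗ₜ[S] baseChangeAux S C D w := rfl

lemma baseChangeAux_eq_distribBaseChange (w : B ⊗[k] C) : baseChangeAux S B C w =
    TensorProduct.AlgebraTensorModule.distribBaseChange k S B C (1 ⊗ₜ w) := by
  induction w with
  | zero => simp
  | add x y hx hy => simp only [map_add, TensorProduct.tmul_add, hx, hy]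
  | tmul b c => rfl

lemma assoc_baseChangeAux (w : B ⊗[k] C) (d : D) :
    Algebra.TensorProduct.assoc S S S (S ⊗[k] B) (S ⊗[k] C) (S ⊗[k] D)
      (baseChangeAux S B C w ⊗ₜ ((1 : S) ⊗ₜ[k] d)) =
    baseChangeAux₃ S B C D (Algebra.TensorProduct.assoc k k k B C D (w ⊗ₜ d)) := by
  induction w with
  | zero => simp
  | add x y hx hy => simp only [map_add, TensorProduct.add_tmul, hx, hy]
  | tmul b c => rfl

/-- A linear map between tensor products over `S` which comes from a bijective map over `k` is
bijective. -/
lemma bijective_of_baseChangeAux {B' C' : Type u} [Ring B'] [Algebra k B'] [Ring C']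
    [Algebra k C'] {f : B ⊗[k] C →ₗ[k] B' ⊗[k] C'} (hf : Function.Bijective f)
    (g : (S ⊗[k] B) ⊗[S] (S ⊗[k] C) →ₗ[S] (S ⊗[k] B') ⊗[S] (S ⊗[k] C'))
    (hg : ∀ b c, g (((1 : S) ⊗ₜ[k] b) ⊗ₜ[S] ((1 : S) ⊗ₜ[k] c)) =
      baseChangeAux S B' C' (f (b ⊗ₜ c))) : Function.Bijective g := by
  let d := TensorProduct.AlgebraTensorModule.distribBaseChange k S B C
  let d' := TensorProduct.AlgebraTensorModule.distribBaseChange k S B' C'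
  let e : (S ⊗[k] B) ⊗[S] (S ⊗[k] C) ≃ₗ[S] (S ⊗[k] B') ⊗[S] (S ⊗[k] C') :=
    d.symm ≪≫ₗ (LinearEquiv.ofBijective f hf).baseChange k S _ _ ≪≫ₗ d'
  have h : g ∘ₗ d.toLinearMap = e.toLinearMap ∘ₗ d.toLinearMap := by
    ext b c
    have h1 : d ((1 : S) ⊗ₜ (b ⊗ₜ c)) = ((1 : S) ⊗ₜ[k] b) ⊗ₜ[S] ((1 : S) ⊗ₜ[k] c) := rfl
    have h2 : e (d (1 ⊗ₜ (b ⊗ₜ c))) = d' (1 ⊗ₜ f (b ⊗ₜ c)) := by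
      simp only [e, LinearEquiv.trans_apply, LinearEquiv.symm_apply_apply]
      rfl
    simpa [h1, hg, baseChangeAux_eq_distribBaseChange] using h2.symm
  have h' : g = e.toLinearMap := LinearMap.ext fun x => by
    obtain ⟨y, rfl⟩ := d.surjective x
    exact DFunLike.congr_fun h y
  rw [h']
  exact e.bijective

end baseChangeAux

open LeftComoduleAlgebra (baseChangeAux baseChangeAux_tmul)

namespace BicomoduleAlgebra

variable {k H K : Type u} [CommRing k] [Ring H] [Bialgebra k H] [Ring K] [Bialgebra k K]
  (S : Type u) [CommRing S] [Algebra k S] (Z : BicomoduleAlgebra k H K)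

/-- The right coaction of the base change. -/
def baseChangeRcoact : S ⊗[k] Z.carrier →ₐ[S] (S ⊗[k] Z.carrier) ⊗[S] (S ⊗[k] K) :=
  (Algebra.TensorProduct.tensorTensorTensorComm k S k S S S Z.carrier K).toAlgHom.comp
    (Algebra.TensorProduct.map (Bialgebra.comulAlgHom S S) Z.rcoact)

lemma baseChangeRcoact_one_tmul (z : Z.carrier) :
    Z.baseChangeRcoact S (1 ⊗ₜ z) = baseChangeAux S Z.carrier K (Z.rcoact z) := by
  simp [baseChangeRcoact, baseChangeAux, Algebra.TensorProduct.one_def]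

/-- The base change of an `H`-`K`-bicomodule algebra over `k` along `k → S`. -/
def baseChange : BicomoduleAlgebra S (S ⊗[k] H) (S ⊗[k] K) where
  toLeftComoduleAlgebra := Z.toLeftComoduleAlgebra.baseChange S
  rcoact := Z.baseChangeRcoact S
  rcoassoc z := by
    suffices h : ((Algebra.TensorProduct.assoc S S S (S ⊗[k] Z.carrier) (S ⊗[k] K)
          (S ⊗[k] K)).toAlgHom.comp (Algebra.TensorProduct.map
          (Z.baseChangeRcoact S) (AlgHom.id S (S ⊗[k] K)))).comp
          (Z.baseChangeRcoact S) = (Algebra.TensorProduct.map (AlgHom.id S (S ⊗[k] Z.carrier))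
          (Bialgebra.comulAlgHom S (S ⊗[k] K))).comp (Z.baseChangeRcoact S) from
      DFunLike.congr_fun h z
    apply Algebra.TensorProduct.ext
    · ext
    · ext z
      have key1 : ∀ w : Z.carrier ⊗[k] K, Algebra.TensorProduct.assoc S S S (S ⊗[k] Z.carrier)
          (S ⊗[k] K) (S ⊗[k] K) (Algebra.TensorProduct.map
          (Z.baseChangeRcoact S) (AlgHom.id S (S ⊗[k] K)) (baseChangeAux S Z.carrier K w)) =
          baseChangeAux₃ S _ _ _ (Algebra.TensorProduct.assoc k k k Z.carrier K K
            (Algebra.TensorProduct.map Z.rcoact (AlgHom.id k K) w)) := by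
        intro w
        induction w with
        | zero => simp
        | add x y hx hy => simp only [map_add, hx, hy]
        | tmul z c =>
          simp only [baseChangeAux_tmul, Algebra.TensorProduct.map_tmul, AlgHom.id_apply,
            baseChangeRcoact_one_tmul]
          exact assoc_baseChangeAux S _ c
      have key2 : ∀ w : Z.carrier ⊗[k] K, Algebra.TensorProduct.map
          (AlgHom.id S (S ⊗[k] Z.carrier)) (Bialgebra.comulAlgHom S (S ⊗[k] K))
          (baseChangeAux S Z.carrier K w) =
          baseChangeAux₃ S _ _ _ (Algebra.TensorProduct.map (AlgHom.id k Z.carrier)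
            (Bialgebra.comulAlgHom k K) w) := by
        intro w
        induction w with
        | zero => simp
        | add x y hx hy => simp only [map_add, hx, hy]
        | tmul z c =>
          simp only [baseChangeAux_tmul, Algebra.TensorProduct.map_tmul, AlgHom.id_apply,
            Bialgebra.comulAlgHom_apply, TensorProduct.comul_tmul, CommSemiring.comul_apply]
          induction Coalgebra.comul (R := k) c with
          | zero => simp
          | add x y hx hy => simp only [map_add, TensorProduct.tmul_add, hx, hy]
          | tmul x y => simp [baseChangeAux₃_tmul, baseChangeAux_tmul]
      have h1 := congrArg (baseChangeAux₃ S _ _ _) (Z.rcoassoc z)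
      rw [← key1, ← key2, ← baseChangeRcoact_one_tmul] at h1
      exact h1
  rcounit z := by
    suffices h : ((Algebra.TensorProduct.rid S S (S ⊗[k] Z.carrier)).toAlgHom.comp
          (Algebra.TensorProduct.map (AlgHom.id S (S ⊗[k] Z.carrier))
            (Bialgebra.counitAlgHom S (S ⊗[k] K)))).comp
          (Z.baseChangeRcoact S) = AlgHom.id S (S ⊗[k] Z.carrier) from DFunLike.congr_fun h z
    apply Algebra.TensorProduct.ext
    · ext
    · ext z
      have key : ∀ w : Z.carrier ⊗[k] K, Algebra.TensorProduct.rid S S (S ⊗[k] Z.carrier)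
          (Algebra.TensorProduct.map (AlgHom.id S (S ⊗[k] Z.carrier))
            (Bialgebra.counitAlgHom S (S ⊗[k] K)) (baseChangeAux S Z.carrier K w)) =
          1 ⊗ₜ[k] Algebra.TensorProduct.rid k k Z.carrier
            (Algebra.TensorProduct.map (AlgHom.id k Z.carrier) (Bialgebra.counitAlgHom k K) w) := by
        intro w
        induction w with
        | zero => simp
        | add x y hx hy => simp only [map_add, hx, hy, TensorProduct.tmul_add]
        | tmul z c =>
          simp only [baseChangeAux_tmul, Algebra.TensorProduct.map_tmul, AlgHom.id_apply,
            Algebra.TensorProduct.rid_tmul]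
          simp
      have h2 := key (Z.rcoact z)
      rw [Z.rcounit, ← baseChangeRcoact_one_tmul] at h2
      exact h2
  coact_rcoact z := by
    suffices h : ((Algebra.TensorProduct.assoc S S S (S ⊗[k] H) (S ⊗[k] Z.carrier)
          (S ⊗[k] K)).toAlgHom.comp (Algebra.TensorProduct.map
          (Z.baseChangeCoact S) (AlgHom.id S (S ⊗[k] K)))).comp
          (Z.baseChangeRcoact S) = (Algebra.TensorProduct.map (AlgHom.id S (S ⊗[k] H))
          (Z.baseChangeRcoact S)).comp (Z.baseChangeCoact S) from
      DFunLike.congr_fun h z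
    apply Algebra.TensorProduct.ext
    · ext
    · ext z
      have key1 : ∀ w : Z.carrier ⊗[k] K, Algebra.TensorProduct.assoc S S S (S ⊗[k] H)
          (S ⊗[k] Z.carrier) (S ⊗[k] K) (Algebra.TensorProduct.map
          (Z.baseChangeCoact S) (AlgHom.id S (S ⊗[k] K)) (baseChangeAux S Z.carrier K w)) =
          baseChangeAux₃ S _ _ _ (Algebra.TensorProduct.assoc k k k H Z.carrier K
            (Algebra.TensorProduct.map Z.coact (AlgHom.id k K) w)) := by
        intro w
        induction w with
        | zero => simp
        | add x y hx hy => simp only [map_add, hx, hy]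
        | tmul z c =>
          simp only [baseChangeAux_tmul, Algebra.TensorProduct.map_tmul, AlgHom.id_apply,
            LeftComoduleAlgebra.baseChangeCoact_one_tmul]
          exact assoc_baseChangeAux S _ c
      have key2 : ∀ w : H ⊗[k] Z.carrier, Algebra.TensorProduct.map
          (AlgHom.id S (S ⊗[k] H)) (Z.baseChangeRcoact S)
          (baseChangeAux S H Z.carrier w) =
          baseChangeAux₃ S _ _ _ (Algebra.TensorProduct.map (AlgHom.id k H) Z.rcoact w) := by
        intro w
        induction w with
        | zero => simp
        | add x y hx hy => simp only [map_add, hx, hy]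
        | tmul h z =>
          simp [baseChangeAux_tmul, baseChangeAux₃_tmul, baseChangeRcoact_one_tmul]
      have h1 := congrArg (baseChangeAux₃ S _ _ _) (Z.coact_rcoact z)
      rw [← key1, ← key2, ← baseChangeRcoact_one_tmul,
        ← LeftComoduleAlgebra.baseChangeCoact_one_tmul] at h1
      exact h1

variable {Z}

/-- A bicomodule algebra which is faithfully flat and has bijective canonical maps is a
bi-Galois object: the coinvariants are automatically trivial. -/
lemma isBiGaloisObject_iff : Z.IsBiGaloisObject ↔
    Function.Bijective Z.can ∧ Function.Bijective Z.rcan ∧ Module.FaithfullyFlat k Z.carrier := by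
  refine ⟨fun h => ⟨h.left.bijective_can, h.bijective_rcan, h.left.faithfullyFlat⟩,
    fun ⟨h1, h2, h3⟩ => ⟨(LeftComoduleAlgebra.isGaloisObject_iff _).mpr ⟨h1, h3⟩,
      eq_bot_iff.mpr fun a ha => ?_, h2⟩⟩
  have ha' : Z.rcoact a = a ⊗ₜ 1 := ha
  have h3 : a ⊗ₜ[k] (1 : Z.carrier) = 1 ⊗ₜ a := h2.1 (by
    simp [rcan, ha', Algebra.TensorProduct.one_def])
  have h4 : ∃ c : k, (TensorProduct.rid k Z.carrier).symm a = 1 ⊗ₜ c := by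
    refine Module.FaithfullyFlat.exists_one_tmul_eq
      (((TensorProduct.rid k Z.carrier).lTensor Z.carrier).injective ?_)
    simpa using h3
  obtain ⟨c, hc⟩ := h4
  rw [LinearEquiv.symm_apply_eq] at hc
  exact ⟨c, by rw [hc]; simp [Algebra.algebraMap_eq_smul_one]⟩

lemma IsBiGaloisObject.baseChange (hZ : Z.IsBiGaloisObject) :
    (Z.baseChange S).IsBiGaloisObject := by
  refine isBiGaloisObject_iff.mpr ⟨?_, ?_, ?_⟩
  · refine bijective_of_baseChangeAux S hZ.left.bijective_can
      (LeftComoduleAlgebra.can (LeftComoduleAlgebra.baseChange S Z.toLeftComoduleAlgebra))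
      fun z z' => ?_
    refine (LeftComoduleAlgebra.can_tmul _ _ _).trans ?_
    rw [LeftComoduleAlgebra.can_tmul, map_mul, ← LeftComoduleAlgebra.baseChangeCoact_one_tmul]
    rfl
  · refine bijective_of_baseChangeAux S hZ.bijective_rcan (Z.baseChange S).rcan
      fun z z' => ?_
    change (((1 : S) ⊗ₜ[k] z) ⊗ₜ 1) * Z.baseChangeRcoact S (1 ⊗ₜ z') =
      baseChangeAux S _ _ ((z ⊗ₜ 1) * Z.rcoact z')
    rw [map_mul, baseChangeRcoact_one_tmul]
    rfl
  · have := hZ.left.faithfullyFlat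
    exact inferInstanceAs (Module.FaithfullyFlat S (S ⊗[k] Z.carrier))

end BicomoduleAlgebra

/-! ### Cotensor products and base change along a retraction of the ground ring -/

open LeftComoduleAlgebra (baseChangeAux baseChangeAux_tmul)


lemma LinearMap.ext_one_tmul {k R M C : Type u} [CommRing k] [CommRing R] [Algebra R k]
    [AddCommGroup M] [Module R M] [AddCommGroup C] [Module k C] {f g : k ⊗[R] M →ₗ[k] C}
    (h : ∀ m, f (1 ⊗ₜ m) = g (1 ⊗ₜ m)) : f = g := by
  ext x
  induction x with
  | zero => simp
  | add x y hx hy => simp only [map_add, hx, hy]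
  | tmul c m =>
    have : c ⊗ₜ[R] m = c • ((1 : k) ⊗ₜ m) := by
      rw [TensorProduct.smul_tmul', smul_eq_mul, mul_one]
    rw [this, map_smul, map_smul, h]

/-- A property of elements of `(R ⊗ V) ⊗_R W` may be checked on the elements `(1 ⊗ v) ⊗ w`. -/
lemma TensorProduct.baseChange_induction {k R V W : Type u} [CommRing k] [CommRing R]
    [Algebra k R] [AddCommGroup V] [Module k V] [AddCommGroup W] [Module R W]
    {p : (R ⊗[k] V) ⊗[R] W → Prop} (h0 : p 0)
    (hadd : ∀ x y, p x → p y → p (x + y)) (h : ∀ v w, p (((1 : R) ⊗ₜ v) ⊗ₜ w)) (x) : p x := by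
  induction x with
  | zero => exact h0
  | add x y hx hy => exact hadd x y hx hy
  | tmul u w =>
    induction u with
    | zero => rwa [TensorProduct.zero_tmul]
    | add x y hx hy => rw [TensorProduct.add_tmul]; exact hadd _ _ hx hy
    | tmul r v =>
      have : r ⊗ₜ[k] v = r • ((1 : R) ⊗ₜ v) := by
        rw [TensorProduct.smul_tmul', smul_eq_mul, mul_one]
      rw [this, TensorProduct.smul_tmul]
      exact h v _

section retractTensor

variable (k : Type u) [CommRing k] (R : Type u) [CommRing R] [Algebra k R] [Algebra R k]
  [IsScalarTower k R k] (V : Type u) [Ring V] [Algebra k V] (W : Type u) [Ring W] [Algebra R W]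

/-- The identification of `k ⊗_R (R ⊗ V)` with `V`. -/
def retractEquiv : k ⊗[R] (R ⊗[k] V) ≃ₐ[k] V :=
  let e := TensorProduct.AlgebraTensorModule.cancelBaseChange k R k k V ≪≫ₗ TensorProduct.lid k V
  have he : ∀ v, e.symm v = 1 ⊗ₜ (1 ⊗ₜ v) := fun _ => rfl
  AlgEquiv.ofLinearEquiv e (by rw [← e.eq_symm_apply]; exact (he 1).symm) (fun x y => by
    obtain ⟨v, rfl⟩ := e.symm.surjective x
    obtain ⟨w, rfl⟩ := e.symm.surjective y
    rw [← e.eq_symm_apply, e.apply_symm_apply, e.apply_symm_apply, he, he, he,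
      Algebra.TensorProduct.tmul_mul_tmul, Algebra.TensorProduct.tmul_mul_tmul, mul_one, mul_one])

/-- The identification of `k ⊗_R ((R ⊗ V) ⊗_R W)` with `V ⊗ (k ⊗_R W)`. -/
def retractTensor : k ⊗[R] ((R ⊗[k] V) ⊗[R] W) ≃ₐ[k] V ⊗[k] (k ⊗[R] W) :=
  (Algebra.TensorProduct.congr (Algebra.TensorProduct.lid k k).symm AlgEquiv.refl).trans <|
    (Algebra.TensorProduct.tensorTensorTensorComm R k R k k k (R ⊗[k] V) W).trans <|
      Algebra.TensorProduct.congr (retractEquiv k R V) AlgEquiv.refl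

variable {V W}

lemma retractTensor_tmul (u : R ⊗[k] V) (w : W) :
    retractTensor k R V W (1 ⊗ₜ (u ⊗ₜ w)) = retractEquiv k R V (1 ⊗ₜ u) ⊗ₜ (1 ⊗ₜ w) := by
  simp [retractTensor]

lemma retractTensor_one_tmul (v : V) (w : W) :
    retractTensor k R V W (1 ⊗ₜ (((1 : R) ⊗ₜ v) ⊗ₜ w)) = v ⊗ₜ (1 ⊗ₜ w) := by
  rw [retractTensor_tmul]
  simp [retractEquiv]

/-- Naturality of `retractTensor`. -/
lemma retractTensor_map {W' : Type u} [Ring W'] [Algebra R W'] (f : W →ₐ[R] W')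
    (y : (R ⊗[k] V) ⊗[R] W) :
    retractTensor k R V W' (1 ⊗ₜ Algebra.TensorProduct.map (AlgHom.id R (R ⊗[k] V)) f y) =
      Algebra.TensorProduct.map (AlgHom.id k V) (Algebra.TensorProduct.map (AlgHom.id k k) f)
        (retractTensor k R V W (1 ⊗ₜ y)) := by
  induction y using TensorProduct.baseChange_induction with
  | h0 => simp
  | hadd x y hx hy => simp only [map_add, TensorProduct.tmul_add, hx, hy]
  | h v w => simp [retractTensor_one_tmul]

/-- A square of maps from `(R ⊗ V) ⊗_R W` to `V₁ ⊗ (V₂ ⊗ (k ⊗_R W))` commutes if it does so on the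
elements `(1 ⊗ v) ⊗ w`. -/
lemma retractTensor_comm {V₁ V₂ : Type u} [Ring V₁] [Algebra k V₁] [Ring V₂] [Algebra k V₂]
    (f : V ⊗[k] (k ⊗[R] W) →ₐ[k] V₁ ⊗[k] (V₂ ⊗[k] (k ⊗[R] W)))
    (g : (R ⊗[k] V) ⊗[R] W →ₐ[R] (R ⊗[k] V₁) ⊗[R] ((R ⊗[k] V₂) ⊗[R] W))
    (h : ∀ v w, f (v ⊗ₜ (1 ⊗ₜ w)) =
      Algebra.TensorProduct.map (AlgHom.id k V₁) (retractTensor k R V₂ W).toAlgHom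
        (retractTensor k R V₁ ((R ⊗[k] V₂) ⊗[R] W) (1 ⊗ₜ g ((1 ⊗ₜ v) ⊗ₜ w))))
    (y : (R ⊗[k] V) ⊗[R] W) :
    f (retractTensor k R V W (1 ⊗ₜ y)) =
      Algebra.TensorProduct.map (AlgHom.id k V₁) (retractTensor k R V₂ W).toAlgHom
        (retractTensor k R V₁ ((R ⊗[k] V₂) ⊗[R] W) (1 ⊗ₜ g y)) := by
  induction y using TensorProduct.baseChange_induction with
  | h0 => simp
  | hadd x y hx hy => simp only [map_add, TensorProduct.tmul_add, hx, hy]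
  | h v w => rw [retractTensor_one_tmul, h]

lemma retractTensor_assoc {V' : Type u} [Ring V'] [Algebra k V'] (u : V ⊗[k] V') (w : W) :
    Algebra.TensorProduct.map (AlgHom.id k V) (retractTensor k R V' W).toAlgHom
      (retractTensor k R V ((R ⊗[k] V') ⊗[R] W) (1 ⊗ₜ Algebra.TensorProduct.assoc R R R _ _ _
        (baseChangeAux R V V' u ⊗ₜ w))) =
      Algebra.TensorProduct.assoc k k k V V' (k ⊗[R] W) (u ⊗ₜ (1 ⊗ₜ w)) := by
  induction u with
  | zero => simp
  | add x y hx hy => simp only [map_add, TensorProduct.add_tmul, TensorProduct.tmul_add, hx, hy]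
  | tmul v v' => simp [baseChangeAux_tmul, retractTensor_one_tmul]

variable {W' : Type u} [Ring W'] [Algebra R W']

/-- The map `k ⊗_R W → V ⊗ (k ⊗_R W')` induced by a map `W → (R ⊗ V) ⊗_R W'`. -/
def retractMap (j : W →ₐ[R] (R ⊗[k] V) ⊗[R] W') : k ⊗[R] W →ₐ[k] V ⊗[k] (k ⊗[R] W') :=
  (retractTensor k R V W').toAlgHom.comp (Algebra.TensorProduct.map (AlgHom.id k k) j)

variable (j : W →ₐ[R] (R ⊗[k] V) ⊗[R] W')

lemma retractMap_one_tmul (w : W) :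
    retractMap k R j (1 ⊗ₜ w) = retractTensor k R V W' (1 ⊗ₜ j w) := rfl

lemma map_retractMap {V₁ : Type u} [Ring V₁] [Algebra k V₁] (u : (R ⊗[k] V₁) ⊗[R] W) :
    Algebra.TensorProduct.map (AlgHom.id k V₁) (retractMap k R j)
      (retractTensor k R V₁ W (1 ⊗ₜ u)) =
      Algebra.TensorProduct.map (AlgHom.id k V₁) (retractTensor k R V W').toAlgHom
        (retractTensor k R V₁ ((R ⊗[k] V) ⊗[R] W')
          (1 ⊗ₜ Algebra.TensorProduct.map (AlgHom.id R (R ⊗[k] V₁)) j u)) := by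
  rw [retractTensor_map, ← AlgHom.comp_apply, ← Algebra.TensorProduct.map_comp]
  rfl

lemma bijective_mulTensor_retractMap
    (hj : Function.Bijective (LinearMap.mulTensor (Algebra.TensorProduct.includeLeft :
      R ⊗[k] V →ₐ[R] (R ⊗[k] V) ⊗[R] W').toLinearMap j.toLinearMap)) :
    Function.Bijective (LinearMap.mulTensor (Algebra.TensorProduct.includeLeft :
      V →ₐ[k] V ⊗[k] (k ⊗[R] W')).toLinearMap (retractMap k R j).toLinearMap) := by
  set E := LinearMap.mulTensor (Algebra.TensorProduct.includeLeft :
      R ⊗[k] V →ₐ[R] (R ⊗[k] V) ⊗[R] W').toLinearMap j.toLinearMap with hE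
  set F := LinearMap.mulTensor (Algebra.TensorProduct.includeLeft :
      V →ₐ[k] V ⊗[k] (k ⊗[R] W')).toLinearMap (retractMap k R j).toLinearMap with hF
  let e := (LinearEquiv.ofBijective E hj).baseChange R k _ _
  have h1 : F ∘ₗ (retractTensor k R V W).toLinearMap =
      (retractTensor k R V W').toLinearMap ∘ₗ e.toLinearMap := by
    apply LinearMap.ext_one_tmul
    intro y
    change F (retractTensor k R V W (1 ⊗ₜ y)) = retractTensor k R V W' (1 ⊗ₜ E y)
    induction y using TensorProduct.baseChange_induction with
    | h0 => simp
    | hadd x y hx hy => simp only [map_add, TensorProduct.tmul_add, hx, hy]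
    | h v w =>
      have h3 : (1 : k) ⊗ₜ[R] ((((1 : R) ⊗ₜ[k] v) ⊗ₜ[R] (1 : W')) * j w) =
          (1 ⊗ₜ (((1 : R) ⊗ₜ[k] v) ⊗ₜ[R] (1 : W'))) * (1 ⊗ₜ j w) := by
        rw [Algebra.TensorProduct.tmul_mul_tmul, mul_one]
      rw [retractTensor_one_tmul, hE, hF, LinearMap.mulTensor_tmul, LinearMap.mulTensor_tmul]
      simp only [AlgHom.toLinearMap_apply, Algebra.TensorProduct.includeLeft_apply]
      rw [h3, map_mul, retractTensor_one_tmul, retractMap_one_tmul,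
        ← Algebra.TensorProduct.one_def]
  have h2 : F = (retractTensor k R V W').toLinearMap ∘ₗ e.toLinearMap ∘ₗ
      (retractTensor k R V W).symm.toLinearMap := by
    rw [← LinearMap.comp_assoc, ← h1]
    ext x
    simp
  rw [h2]
  exact (retractTensor k R V W').bijective.comp
    (e.bijective.comp (retractTensor k R V W).symm.bijective)

end retractTensor

lemma LeftComoduleAlgebra.retract_coact_one_tmul {k H : Type u} [CommRing k] [Ring H]
    [Bialgebra k H] {R : Type u} [CommRing R] [Algebra k R] [Algebra R k] [IsScalarTower k R k]
    (A : LeftComoduleAlgebra R (R ⊗[k] H)) (a : A) :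
    A.retract.coact (1 ⊗ₜ[R] a : k ⊗[R] A) = retractTensor k R H A (1 ⊗ₜ A.coact a) := by
  change Algebra.TensorProduct.map _ (AlgHom.id k (k ⊗[R] A)) (A.baseChangeCoact k (1 ⊗ₜ a)) = _
  rw [baseChangeCoact_one_tmul]
  induction A.coact a with
  | zero => simp
  | add x y hx hy => simp only [map_add, TensorProduct.tmul_add, hx, hy]
  | tmul u a =>
    rw [retractTensor_tmul, baseChangeAux_tmul]
    rfl

namespace BicomoduleAlgebra

variable {k H K : Type u} [CommRing k] [Ring H] [Bialgebra k H] [Ring K] [Bialgebra k K]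
  (Z : BicomoduleAlgebra k H K) {R : Type u} [CommRing R] [Algebra k R] [Algebra R k]
  [IsScalarTower k R k] (A : LeftComoduleAlgebra R (R ⊗[k] K))

lemma rcoactId_retractTensor (y : (R ⊗[k] Z.carrier) ⊗[R] A) :
    Z.rcoactId A.retract (retractTensor k R Z.carrier A (1 ⊗ₜ y)) =
      Algebra.TensorProduct.map (AlgHom.id k Z.carrier) (retractTensor k R K A).toAlgHom
        (retractTensor k R Z.carrier ((R ⊗[k] K) ⊗[R] A)
          (1 ⊗ₜ (Z.baseChange R).rcoactId A y)) := by
  refine retractTensor_comm k R (Z.rcoactId A.retract) ((Z.baseChange R).rcoactId A)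
    (fun z a => ?_) y
  refine (retractTensor_assoc k R (Z.rcoact z) a).symm.trans ?_
  rw [← baseChangeRcoact_one_tmul]
  rfl

lemma idCoact_retractTensor (y : (R ⊗[k] Z.carrier) ⊗[R] A) :
    Z.idCoact A.retract (retractTensor k R Z.carrier A (1 ⊗ₜ y)) =
      Algebra.TensorProduct.map (AlgHom.id k Z.carrier) (retractTensor k R K A).toAlgHom
        (retractTensor k R Z.carrier ((R ⊗[k] K) ⊗[R] A)
          (1 ⊗ₜ (Z.baseChange R).idCoact A y)) := by
  refine retractTensor_comm k R (Z.idCoact A.retract) ((Z.baseChange R).idCoact A)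
    (fun z a => ?_) y
  have h1 := retractTensor_one_tmul k R z (A.coact a)
  refine (congrArg (z ⊗ₜ[k] ·) (A.retract_coact_one_tmul a)).trans ?_
  exact (congrArg (Algebra.TensorProduct.map (AlgHom.id k Z.carrier)
    (retractTensor k R K A).toAlgHom) h1).symm

lemma coactId_retractTensor (y : (R ⊗[k] Z.carrier) ⊗[R] A) :
    Z.coactId A.retract (retractTensor k R Z.carrier A (1 ⊗ₜ y)) =
      Algebra.TensorProduct.map (AlgHom.id k H) (retractTensor k R Z.carrier A).toAlgHom
        (retractTensor k R H ((R ⊗[k] Z.carrier) ⊗[R] A)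
          (1 ⊗ₜ (Z.baseChange R).coactId A y)) := by
  refine retractTensor_comm k R (Z.coactId A.retract) ((Z.baseChange R).coactId A)
    (fun z a => ?_) y
  refine (retractTensor_assoc k R (Z.coact z) a).symm.trans ?_
  rw [← LeftComoduleAlgebra.baseChangeCoact_one_tmul]
  rfl

variable {Z A} {X : LeftComoduleAlgebra R (R ⊗[k] H)}
  {i : X →ₐ[R] (Z.baseChange R).carrier ⊗[R] A}

lemma coactId_retractMap (h : (Z.baseChange R).IsCotensor A X i) (x : k ⊗[R] X) :
    Z.coactId A.retract (retractMap k R (V := Z.carrier) (W' := A) i x) =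
      Algebra.TensorProduct.map (AlgHom.id k H) (retractMap k R (V := Z.carrier) (W' := A) i)
        (X.retract.coact x) := by
  refine DFunLike.congr_fun (LinearMap.ext_one_tmul (M := X)
    (f := (Z.coactId A.retract).toLinearMap ∘ₗ
      (retractMap k R (V := Z.carrier) (W' := A) i).toLinearMap)
    (g := (Algebra.TensorProduct.map (AlgHom.id k H)
      (retractMap k R (V := Z.carrier) (W' := A) i)).toLinearMap ∘ₗ
        X.retract.coact.toLinearMap) fun x => ?_) x
  refine (Z.coactId_retractTensor A (i x)).trans ?_
  rw [h.coact]
  refine (map_retractMap k R (V := Z.carrier) (W' := A) i (X.coact x)).symm.trans ?_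
  exact congrArg (Algebra.TensorProduct.map (AlgHom.id k H)
    (retractMap k R (V := Z.carrier) (W' := A) i)) (X.retract_coact_one_tmul x).symm

lemma rcoactId_retractMap (h : (Z.baseChange R).IsCotensor A X i) (x : k ⊗[R] X) :
    Z.rcoactId A.retract (retractMap k R (V := Z.carrier) (W' := A) i x) =
      Z.idCoact A.retract (retractMap k R (V := Z.carrier) (W' := A) i x) := by
  refine DFunLike.congr_fun (LinearMap.ext_one_tmul (M := X)
    (f := (Z.rcoactId A.retract).toLinearMap ∘ₗ
      (retractMap k R (V := Z.carrier) (W' := A) i).toLinearMap)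
    (g := (Z.idCoact A.retract).toLinearMap ∘ₗ
      (retractMap k R (V := Z.carrier) (W' := A) i).toLinearMap) fun x => ?_) x
  refine (Z.rcoactId_retractTensor A (i x)).trans (Eq.trans ?_
    (Z.idCoact_retractTensor A (i x)).symm)
  rw [(h.mem_range_iff _).mp ⟨x, rfl⟩]

/-- Cotensor products with a bi-Galois object are compatible with base change along `R → k`. -/
lemma IsCotensor.retract (hZ : Z.IsBiGaloisObject) (h : (Z.baseChange R).IsCotensor A X i) :
    ∃ i', Z.IsCotensor A.retract X.retract i' := by
  have := hZ.left.faithfullyFlat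
  have := (hZ.baseChange R).left.faithfullyFlat
  exact ⟨retractMap k R (V := Z.carrier) (W' := A) i,
    isCotensor_of_bijective_extend hZ.bijective_rcan (rcoactId_retractMap h)
      (coactId_retractMap h) (bijective_mulTensor_retractMap k R (V := Z.carrier) (W' := A) i
        (h.bijective_extend (hZ.baseChange R).bijective_rcan))⟩

end BicomoduleAlgebra

/-! ### The bijection between homotopy classes -/

namespace BicomoduleAlgebra

variable {k H K : Type u} [CommRing k] [Ring H] [Bialgebra k H] [Ring K] [Bialgebra k K]
  {Z : BicomoduleAlgebra k H K}

/-- Cotensor products with a bi-Galois object are compatible with evaluation `k[t] → k`. -/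
lemma IsCotensor.specialize (hZ : Z.IsBiGaloisObject)
    {A : LeftComoduleAlgebra k[X] (k[X] ⊗[k] K)} {B : LeftComoduleAlgebra k[X] (k[X] ⊗[k] H)}
    {i : B →ₐ[k[X]] (Z.baseChange k[X]).carrier ⊗[k[X]] A}
    (h : (Z.baseChange k[X]).IsCotensor A B i) (c : k) :
    ∃ i', Z.IsCotensor (A.specialize c) (B.specialize c) i' := by
  let := LeftComoduleAlgebra.evalAlgebra c
  have := LeftComoduleAlgebra.evalAlgebra_isScalarTower c
  exact h.retract hZ

end BicomoduleAlgebra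
end

open BicomoduleAlgebra in
theorem proposition1 (k H K : Type u) [CommRing k] [Ring H] [HopfAlgebra k H] [Ring K]
    [HopfAlgebra k K] (Z : BicomoduleAlgebra k H K) (hZ : Z.IsBiGaloisObject) :
    ∃ (hgal : ∀ A : GaloisObject k K, (Z.cotensor A.1 hZ.left.flat).IsGaloisObject)
      (φ : Gal k K → Gal k H),
      (∀ A : GaloisObject k K, φ (Gal.mk A) = Gal.mk ⟨Z.cotensor A.1 hZ.left.flat, hgal A⟩) ∧
      Function.Bijective φ ∧
      (∀ x y : Gal k K, x.Homotopic y ↔ (φ x).Homotopic (φ y)) ∧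
      ∃ φbar : HomotopyClasses k K → HomotopyClasses k H,
        (∀ x : Gal k K, φbar x.homotopyClass = (φ x).homotopyClass) ∧
        Function.Bijective φbar := by
  have hgal (A : GaloisObject k K) : (Z.cotensor A.1 hZ.left.flat).IsGaloisObject :=
    ((Z.isCotensor_cotensor A.1 hZ.left.flat).isGaloisObject_iff hZ).mpr A.2
  have hiso (A A' : GaloisObject k K) : (Z.cotensor A.1 hZ.left.flat).Isomorphic
      (Z.cotensor A'.1 hZ.left.flat) ↔ A.1.Isomorphic A'.1 :=
    (Z.isCotensor_cotensor A.1 _).isomorphic_iff hZ (Z.isCotensor_cotensor A'.1 _)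
  let φ : Gal k K → Gal k H := Quotient.map
    (fun A => ⟨Z.cotensor A.1 hZ.left.flat, hgal A⟩) fun A A' h => (hiso A A').mpr h
  have hφ : Function.Bijective φ := by
    constructor
    · rintro ⟨A⟩ ⟨A'⟩ h
      exact Quotient.sound ((hiso A A').mp (Quotient.exact h))
    · rintro ⟨B⟩
      obtain ⟨A, i, h⟩ := Z.exists_isCotensor B.1 hZ
      exact ⟨Gal.mk ⟨A, (h.isGaloisObject_iff hZ).mp B.2⟩, Quotient.sound
        ((Z.isCotensor_cotensor A hZ.left.flat).isomorphic_right hZ.left.flat h)⟩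
  have hZt := hZ.baseChange k[X]
  have hhom (x y : Gal k K) : x.Homotopic y ↔ (φ x).Homotopic (φ y) := by
    constructor
    · rintro ⟨A, A₀, A₁, rfl, rfl, h₀, h₁⟩
      have hA := (Z.baseChange k[X]).isCotensor_cotensor A.1 hZt.left.flat
      obtain ⟨_, hA₀⟩ := hA.specialize hZ 0
      obtain ⟨_, hA₁⟩ := hA.specialize hZ 1
      exact ⟨⟨_, (hA.isGaloisObject_iff hZt).mpr A.2⟩, ⟨_, hgal A₀⟩, ⟨_, hgal A₁⟩, rfl, rfl,
        (hA₀.isomorphic_iff hZ (Z.isCotensor_cotensor A₀.1 _)).mpr h₀,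
        (hA₁.isomorphic_iff hZ (Z.isCotensor_cotensor A₁.1 _)).mpr h₁⟩
    · rintro ⟨B, B₀, B₁, hx, hy, h₀, h₁⟩
      obtain ⟨A₀, rfl⟩ := Quotient.exists_rep x
      obtain ⟨A₁, rfl⟩ := Quotient.exists_rep y
      obtain ⟨A, i, hA⟩ := (Z.baseChange k[X]).exists_isCotensor B.1 hZt
      obtain ⟨_, hA₀⟩ := hA.specialize hZ 0
      obtain ⟨_, hA₁⟩ := hA.specialize hZ 1
      exact ⟨⟨A, (hA.isGaloisObject_iff hZt).mp B.2⟩, A₀, A₁, rfl, rfl,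
        (hA₀.isomorphic_iff hZ (Z.isCotensor_cotensor A₀.1 _)).mp
          (h₀.trans (Quotient.exact hx).symm),
        (hA₁.isomorphic_iff hZ (Z.isCotensor_cotensor A₁.1 _)).mp
          (h₁.trans (Quotient.exact hy).symm)⟩
  refine ⟨hgal, φ, fun _ => rfl, hφ, hhom, Quot.map φ fun x y => (hhom x y).mp, fun _ => rfl,
    ?_, ?_⟩
  · let e := Equiv.ofBijective φ hφ
    let ψ : HomotopyClasses k H → HomotopyClasses k K := Quot.map e.symm fun x y h =>
      (hhom _ _).mpr (by
        change (e (e.symm x)).Homotopic (e (e.symm y))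
        rwa [e.apply_symm_apply, e.apply_symm_apply])
    have hψ : Function.LeftInverse ψ (Quot.map φ fun x y => (hhom x y).mp) := by
      rintro ⟨x⟩
      exact congrArg (Quot.mk _) (e.symm_apply_apply x)
    exact hψ.injective
  · rintro ⟨y⟩
    obtain ⟨x, rfl⟩ := hφ.2 y
    exact ⟨Quot.mk _ x, rfl⟩
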